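/- For $n\ge 1$ consider finite subgroups $\Gamma$ of order $n$ of the diagonal torus $\{(t_1,\dots,t_4)\in(\mathbb C^\times)^4: t_1t_2t_3t_4=1\}$ acting on $\mathbb C^4$; the Abelian orbifolds $\mathbb C^4/\Gamma$ with $|\Gamma|=n$ are counted up to permutations of the four coordinates. Let $L=\{v\in\mathbb Z^4: v_1+v_2+v_3+v_4=0\}$ be the translation lattice of the bipartite tetrahedral (diamond) lattice, generated by the edge vectors $e_i-e_j$ of a regular tetrahedron, with $S_4$ permuting the coordinates. Let $f(n)$ be the number of $S_4$-orbits on the set of sublattices of $L$ of index $n$, and for $\sigma\in S_4$ let $f_\sigma(n)$ be the number of sublattices of index $n$ with $\sigma(L')=L'$. This depends only on the cycle type of $\sigma$; write $f_{x_1^4},f_{x_1^2x_2},f_{x_2^2},f_{x_1x_3},f_{x_4}$ for the five cases. Let $*$ denote Dirichlet convolution, $\mathbf 1=\{1,1,1,\dots\}$, $N=\{1,2,3,\dots\}$, $N^2=\{1,4,9,\dots\}$, let a finite list $\{a_1,\dots,a_k\}$ denote the sequence continued by zeros, and let $\chi_{3,2},\chi_{4,2}$ be the non-principal Dirichlet characters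 modulo $3$ and $4$. Then: 1. For all $n\ge1$, the number of Abelian orbifolds of $\mathbb C^4$ of order $n$ equals $f(n)$. 2. On $n\ge 1$, $$f_{x_1^4}=\mathbf 1*N*N^2,\qquad f_{x_1^2x_2}=f_{x_2^2}=\{1,-1,0,4\}*\mathbf 1*\mathbf 1*N,$$ $$f_{x_1x_3}=\{1,0,-1,0,0,0,0,0,3\}*\mathbf 1*\mathbf 1*\chi_{3,2},\qquad f_{x_4}=\{1,-1,0,2\}*\mathbf 1*\mathbf 1*\chi_{4,2},$$ and $f=\frac1{24}\left(f_{x_1^4}+6f_{x_1^2x_2}+3f_{x_2^2}+8f_{x_1x_3}+6f_{x_4}\right)$. 3. The Dirichlet series $\sum_{n\ge1} f_{\bullet}(n)n^{-s}$ converge absolutely to $\zeta(s)\zeta(s-1)\zeta(s-2)$ for $x_1^4$ ($\Re s>3$); $(1-2^{-s}+2^{2-2s})\zeta(s)^2\zeta(s-1)$ for $x_1^2x_2$ and $x_2^2$ ($\Re s>2$); $(1-3^{-s}+3^{1-2s})\zeta(s)^2L(s,\chi_{3,2})$ for $x_1x_3$ ($\Re s>1$); $(1-2^{-s}+2^{1-2s})\zeta(s)^2L(s,\chi_{4,2})$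 for $x_4$ ($\Re s>1$). 4. For $\Re s>3$ the series $F(s)=\sum_{n\ge1}f(n)n^{-s}$ converges absolutely and $$F(s)=\frac{\zeta(s)\zeta(s-1)}{24}\Bigl(\zeta(s-2)+9\,(1-2^{-s}+2^{2-2s})\,\zeta(s)\Bigr)+\frac{\zeta(s)^2}{24}\Bigl(8\,(1-3^{-s}+3^{1-2s})\,L(s,\chi_{3,2})+6\,(1-2^{-s}+2^{1-2s})\,L(s,\chi_{4,2})\Bigr).$$ 5. The right-hand side is meromorphic on $\mathbb C$; its rightmost pole is at $s=3$ and has order $1$, and it is holomorphic at every other point with $\Re s\ge3$. -/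

import Mathlib

/-! ### The tetrahedral lattice and its sublattices up to `S₄` -/

/-- The translation lattice of the bipartite tetrahedral (diamond) lattice, in the coordinates
where the four neighbours of a vertex sit at the corners `e₀, e₁, e₂, e₃` of a regular tetrahedron,
and the vertex itself at the barycentre `(1/4, 1/4, 1/4, 1/4)`.
The translations preserving the bipartite lattice and its colouring are generated by the edge
vectors `eᵢ - eⱼ`: they are the integer vectors with coordinate sum zero, a lattice of rank three
(the face centred cubic lattice). -/
def tetraLattice : AddSubgroup (Fin 4 → ℤ) where
  carrier := {v | ∑ i, v i = 0}
  zero_mem' := by simp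
  add_mem' := by
    intro a b ha hb
    simp only [Set.mem_ofPred_eq, Pi.add_apply, Finset.sum_add_distrib] at *
    omega
  neg_mem' := by
    intro a ha
    simp only [Set.mem_ofPred_eq, Pi.neg_apply, Finset.sum_neg_distrib] at *
    omega

/-- A permutation of the four corners of the tetrahedron acts on the lattice by `eᵢ ↦ e_{σ i}`. -/
def permLattice (σ : Equiv.Perm (Fin 4)) : tetraLattice ≃+ tetraLattice where
  toFun v := ⟨fun i => v.1 (σ.symm i), by
    have h : ∑ i, v.1 i = 0 := v.2
    change ∑ i, v.1 (σ.symm i) = 0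
    rw [← h]
    exact Equiv.sum_comp σ.symm v.1⟩
  invFun v := ⟨fun i => v.1 (σ i), by
    have h : ∑ i, v.1 i = 0 := v.2
    change ∑ i, v.1 (σ i) = 0
    rw [← h]
    exact Equiv.sum_comp σ v.1⟩
  left_inv v := by ext i; simp
  right_inv v := by ext i; simp
  map_add' v w := by ext i; simp

/-- The sublattices of index `n` of the tetrahedral lattice. -/
def TetraSublattice (n : ℕ) : Type := {L : AddSubgroup tetraLattice // L.index = n}

/-- The symmetric group `S₄` acts on the sublattices of index `n`, taking images. -/
instance (n : ℕ) : MulAction (Equiv.Perm (Fin 4)) (TetraSublattice n) where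
  smul σ L := ⟨L.1.map (permLattice σ).toAddMonoidHom, by
    rw [AddSubgroup.index_map_of_bijective (f := (permLattice σ).toAddMonoidHom)
      (permLattice σ).bijective]
    exact L.2⟩
  one_smul L := by
    apply Subtype.ext
    change L.1.map (permLattice 1).toAddMonoidHom = L.1
    exact AddSubgroup.map_id L.1
  mul_smul σ τ L := by
    apply Subtype.ext
    change L.1.map (permLattice (σ * τ)).toAddMonoidHom =
      (L.1.map (permLattice τ).toAddMonoidHom).map (permLattice σ).toAddMonoidHom
    rw [AddSubgroup.map_map]
    rfl

/-- `tetraCount n` is the number of sublattices of index `n`, counted up to `S₄`. -/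
noncomputable def tetraCount (n : ℕ) : ℕ :=
  Nat.card (MulAction.orbitRel.Quotient (Equiv.Perm (Fin 4)) (TetraSublattice n))

/-- `tetraFixed σ n` is the number of sublattices of index `n` that are left invariant by `σ`. -/
noncomputable def tetraFixed (σ : Equiv.Perm (Fin 4)) (n : ℕ) : ℕ :=
  Nat.card (MulAction.fixedBy (TetraSublattice n) σ)

/-! ### Abelian orbifolds of `ℂ⁴` -/

/-- The Abelian orbifold groups of order `n`: a group of diagonal matrices
`z ↦ (t₀ z₀, t₁ z₁, t₂ z₂, t₃ z₃)` acting on `ℂ⁴` with determinant one (for a cyclic group with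
generator `(ω ^ a₀, …, ω ^ a₃)` this says `a₀ + a₁ + a₂ + a₃ = 0` modulo `n`). -/
def OrbifoldGroup (n : ℕ) : Type :=
  {Γ : Subgroup (Fin 4 → ℂˣ) // (∀ t ∈ Γ, ∏ i, t i = 1) ∧ Nat.card Γ = n}

/-- A permutation of the four coordinates of `ℂ⁴` acts on diagonal matrices. -/
def permTorus (σ : Equiv.Perm (Fin 4)) : (Fin 4 → ℂˣ) ≃* (Fin 4 → ℂˣ) where
  toFun t := fun i => t (σ.symm i)
  invFun t := fun i => t (σ i)
  left_inv t := by ext i; simp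
  right_inv t := by ext i; simp
  map_mul' t u := by ext i; simp

/-- The symmetric group `S₄` acts on orbifold groups by permuting the coordinates of `ℂ⁴`. -/
instance (n : ℕ) : MulAction (Equiv.Perm (Fin 4)) (OrbifoldGroup n) where
  smul σ Γ := ⟨Γ.1.map (permTorus σ).toMonoidHom, by
    constructor
    · rintro _ ⟨t, ht, rfl⟩
      rw [← Γ.2.1 t ht]
      exact Equiv.prod_comp σ.symm t
    · refine Eq.trans ?_ Γ.2.2
      exact (Nat.card_congr (Γ.1.equivMapOfInjective (permTorus σ).toMonoidHom
        (permTorus σ).injective).toEquiv).symm⟩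
  one_smul Γ := by
    apply Subtype.ext
    change Γ.1.map (permTorus 1).toMonoidHom = Γ.1
    exact Subgroup.map_id Γ.1
  mul_smul σ τ Γ := by
    apply Subtype.ext
    change Γ.1.map (permTorus (σ * τ)).toMonoidHom =
      (Γ.1.map (permTorus τ).toMonoidHom).map (permTorus σ).toMonoidHom
    rw [Subgroup.map_map]
    rfl

/-- The number of inequivalent orbifolds `ℂ⁴ / Γ` with `Γ` Abelian of order `n`: two of them are
equivalent if they differ by a permutation of the coordinates. -/
noncomputable def orbifoldCount (n : ℕ) : ℕ :=
  Nat.card (MulAction.orbitRel.Quotient (Equiv.Perm (Fin 4)) (OrbifoldGroup n))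

/-! ### Sequences; the product of `ArithmeticFunction ℤ` is the Dirichlet convolution -/

/-- The finite sequence `{a₁, a₂, …, a_k}`, continued by zeros. -/
def finiteSeq (l : List ℤ) : ArithmeticFunction ℤ :=
  ⟨fun n => if n = 0 then 0 else l.getD (n - 1) 0, by simp⟩

/-- The sequence `{1, 1, 1, …}`. -/
def oneSeq : ArithmeticFunction ℤ := ⟨fun n => if n = 0 then 0 else 1, by simp⟩

/-- The sequence `{1, 2, 3, …}`. -/
def natSeq : ArithmeticFunction ℤ := ⟨fun n => (n : ℤ), by simp⟩

/-- The sequence `{1, 4, 9, …}`. -/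
def sqSeq : ArithmeticFunction ℤ := ⟨fun n => (n : ℤ) ^ 2, by simp⟩

/-- The non-principal character modulo three, with values `1, -1, 0, 1, -1, 0, …`. -/
def chiThree : MulChar (ZMod 3) ℤ := quadraticChar (ZMod 3)

/-- The non-principal character modulo four, with values `1, 0, -1, 0, 1, 0, -1, 0, …`. -/
def chiFour : MulChar (ZMod 4) ℤ := ZMod.χ₄

def chiThreeSeq : ArithmeticFunction ℤ := ⟨fun n => chiThree (n : ZMod 3), by decide⟩

def chiFourSeq : ArithmeticFunction ℤ := ⟨fun n => chiFour (n : ZMod 4), by decide⟩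

/-- `L(s, χ_{3,2})`, as an entire function. -/
noncomputable def LChiThree (s : ℂ) : ℂ :=
  DirichletCharacter.LFunction (chiThree.ringHomComp (Int.castRingHom ℂ)) s

/-- `L(s, χ_{4,2})`, as an entire function. -/
noncomputable def LChiFour (s : ℂ) : ℂ :=
  DirichletCharacter.LFunction (chiFour.ringHomComp (Int.castRingHom ℂ)) s

/-- The closed form of the Dirichlet series, as a function on the complex plane. -/
noncomputable def tetraDirichlet (s : ℂ) : ℂ :=
  riemannZeta s * riemannZeta (s - 1) / 24 *
      (riemannZeta (s - 2) + 9 * (1 - 2 ^ (-s) + 2 ^ (2 - 2 * s)) * riemannZeta s) +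
    riemannZeta s ^ 2 / 24 *
      (8 * (1 - 3 ^ (-s) + 3 ^ (1 - 2 * s)) * LChiThree s +
        6 * (1 - 2 ^ (-s) + 2 ^ (1 - 2 * s)) * LChiFour s)

/-!
# Sublattices of the tetrahedral lattice up to `S₄`

**Orbifolds and sublattices.** A finite subgroup `Γ` of the diagonal torus is determined by the
exponents of the characters of `(ℂˣ)⁴` that are trivial on it, a sublattice of `ℤ⁴` of index `|Γ|`,
which contains `(1, 1, 1, 1)` exactly when `Γ` has determinant one (`orbifoldEquiv`). So orbifold
groups of order `n` correspond, compatibly with `S₄`, to the sublattices of index `n` of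
`ℤ⁴ / ℤ (1, 1, 1, 1)`, the dual of the tetrahedral lattice `L`. This dual is not isomorphic to `L`
as a lattice with an action of `S₄`, but it is isomorphic to `L` as a lattice with an action of any
single `σ`, by an explicit map for each cycle type. So `σ` fixes as many orbifold groups as
sublattices (`card_fixedBy_orbifoldGroup_eq`), and by Burnside's lemma the orbits are equally
many. Burnside's lemma also gives the decomposition by the cycle index.

**Invariant sublattices.** For each cycle type there is a basis of `L` in which `σ` acts on
`L = B × ℤ` by `(b, z) ↦ (β b + z u, ε z)`. An invariant sublattice of `B × ℤ` has a trace `H`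
on `B`, which is invariant under `β`, a projection `k ℤ`, and an element `(x, k)`, whose first entry
solves `(β - ε) x = -k u` in `B ⧸ H` (`extEquiv`). This equation has `[B : H + (β - ε) B]`
solutions if `k u` lies in `H + (β - ε) B`, and none otherwise (`card_extSol`). For a reflection
or a double transposition `B` is `ℤ²` with an exchange of coordinates, treated by the same method.
For a `3`-cycle and a `4`-cycle `B` is the ring of Eisenstein or of Gaussian integers, `H` is an
ideal and `β - ε` is multiplication by a generator of the ramified prime, of norm `p = 3` or
`p = 2`: an ideal `H` outside this prime contributes one sublattice for every `k`, an ideal inside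
contributes `p` sublattices for every multiple `k` of `p` (`invCount_extEnd_prime`), which is the
factor `1 - p⁻ˢ + p¹⁻²ˢ`. The ideals themselves are counted by `𝟏 * χ`, according to the
decomposition of primes in the cyclotomic field (`idealCount_cyclotomic`).

**Dirichlet series.** Convolutions become products of `L`-series. In the resulting expression the
only factor with a pole on `3 ≤ re s` is `ζ(s - 2)`; its pole at `s = 3` is simple, and its
coefficient `ζ(3) ζ(2) / 24` does not vanish.
-/

/-! ### Invariant subgroups of an extension of `ℤ` -/

/-- The subgroups of index `n` of `A` that are mapped into themselves by the endomorphism `α`.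
When `α` is an automorphism and `n` is positive these are the subgroups of index `n` fixed by
`α`. -/
def InvSub {A : Type*} [AddCommGroup A] (α : A →+ A) (n : ℕ) : Type _ :=
  {H : AddSubgroup A // H.index = n ∧ ∀ a ∈ H, α a ∈ H}

/-- The number of subgroups of index `n` that are invariant under `α`. -/
noncomputable def invCount {A : Type*} [AddCommGroup A] (α : A →+ A) (n : ℕ) : ℕ :=
  Nat.card (InvSub α n)

/-- The endomorphism `(b, z) ↦ (β b + z u, ε z)` of `B × ℤ`: an extension of the lattice `ℤ`, on
which it is multiplication by `ε`, by the group `B` with endomorphism `β`. -/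
def extEnd {B : Type*} [AddCommGroup B] (β : B →+ B) (u : B) (ε : ℤ) : B × ℤ →+ B × ℤ where
  toFun p := (β p.1 + p.2 • u, ε * p.2)
  map_zero' := by simp
  map_add' p q := by
    ext
    · simp only [Prod.fst_add, Prod.snd_add, map_add, add_smul]; abel
    · simp only [Prod.snd_add]; ring

@[simp] lemma extEnd_apply {B : Type*} [AddCommGroup B] (β : B →+ B) (u : B) (ε : ℤ) (p : B × ℤ) :
    extEnd β u ε p = (β p.1 + p.2 • u, ε * p.2) := rfl

section Ext

variable {B : Type*} [AddCommGroup B]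

/-- The subgroup of `B × ℤ` generated by `H × 0` and `(b, k)`. -/
def extSub (H : AddSubgroup B) (b : B) (k : ℕ) : AddSubgroup (B × ℤ) where
  carrier := {p | ∃ q : ℤ, p.2 = q * k ∧ p.1 - q • b ∈ H}
  zero_mem' := ⟨0, by simp, by simp⟩
  add_mem' := by
    rintro p p' ⟨q, hq, h⟩ ⟨q', hq', h'⟩
    refine ⟨q + q', by simp [hq, hq', add_mul], ?_⟩
    have := H.add_mem h h'
    simpa [add_smul, add_sub_add_comm] using this
  neg_mem' := by
    rintro p ⟨q, hq, h⟩
    refine ⟨-q, by simp [hq], ?_⟩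
    have := H.neg_mem h
    simpa [neg_add_eq_sub, sub_eq_add_neg, add_comm] using this

lemma mem_extSub {H : AddSubgroup B} {b : B} {k : ℕ} {p : B × ℤ} :
    p ∈ extSub H b k ↔ ∃ q : ℤ, p.2 = q * k ∧ p.1 - q • b ∈ H := Iff.rfl

lemma gen_mem_extSub (H : AddSubgroup B) (b : B) (k : ℕ) : (b, (k : ℤ)) ∈ extSub H b k :=
  ⟨1, by simp, by simp⟩

lemma extSub_comap_inl {H : AddSubgroup B} {b : B} {k : ℕ} (hk : k ≠ 0) :
    (extSub H b k).comap (AddMonoidHom.inl B ℤ) = H := by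
  ext x
  simp only [AddSubgroup.mem_comap, mem_extSub, AddMonoidHom.inl_apply]
  constructor
  · rintro ⟨q, hq, h⟩
    have : q = 0 := by simpa [hk] using hq.symm
    simpa [this] using h
  · intro h
    exact ⟨0, by simp, by simpa using h⟩

lemma extSub_map_snd {H : AddSubgroup B} {b : B} {k : ℕ} :
    (extSub H b k).map (AddMonoidHom.snd B ℤ) = AddSubgroup.zmultiples (k : ℤ) := by
  ext z
  simp only [AddSubgroup.mem_map, AddSubgroup.mem_zmultiples_iff, AddMonoidHom.coe_snd, smul_eq_mul]
  constructor
  · rintro ⟨p, ⟨q, hq, -⟩, rfl⟩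
    exact ⟨q, hq.symm⟩
  · rintro ⟨q, rfl⟩
    exact ⟨(q • b, q * k), ⟨q, rfl, by simp⟩, rfl⟩

/-- The index of a subgroup of `B × ℤ` is the product of the indices of its trace on `B` and of its
projection to `ℤ`. -/
lemma index_eq_map_snd_mul (H : AddSubgroup (B × ℤ)) :
    H.index = (H.map (AddMonoidHom.snd B ℤ)).index * (H.comap (AddMonoidHom.inl B ℤ)).index := by
  have hr : (AddMonoidHom.inl B ℤ).range = (AddMonoidHom.snd B ℤ).ker := by
    ext ⟨b, z⟩
    rw [AddMonoidHom.mem_ker]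
    simp [eq_comm]
  have hs : (AddMonoidHom.snd B ℤ).range = ⊤ :=
    AddMonoidHom.range_eq_top.2 fun z => ⟨(0, z), rfl⟩
  rw [AddSubgroup.index_map, AddSubgroup.index_comap, hr, hs, AddSubgroup.index_top, mul_one,
    ← AddSubgroup.relIndex_sup_left, mul_comm, sup_comm,
    AddSubgroup.relIndex_mul_index le_sup_right]

lemma index_extSub {H : AddSubgroup B} {b : B} {k : ℕ} (hk : k ≠ 0) :
    (extSub H b k).index = k * H.index := by
  rw [index_eq_map_snd_mul, extSub_map_snd, extSub_comap_inl hk, Int.index_zmultiples]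
  simp

lemma extSub_invariant {β : B →+ B} {u : B} {ε : ℤ} {H : AddSubgroup B} {b : B} {k : ℕ}
    (hH : ∀ a ∈ H, β a ∈ H) (hb : β b - ε • b + k • u ∈ H) :
    ∀ p ∈ extSub H b k, extEnd β u ε p ∈ extSub H b k := by
  rintro ⟨c, z⟩ ⟨q, hq, h⟩
  simp only at hq h
  subst hq
  refine ⟨ε * q, by simp only [extEnd_apply]; ring, ?_⟩
  have := H.add_mem (hH _ h) (H.zsmul_mem hb q)
  convert this using 1
  simp only [extEnd_apply, map_sub, map_zsmul, smul_add, smul_sub, mul_smul, natCast_zsmul]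
  rw [smul_comm ε q b]
  abel

/-- An invariant subgroup of `B × ℤ` is `extSub` of its trace on `B` and of any of its elements over
a generator of its projection to `ℤ`. -/
lemma eq_extSub {L : AddSubgroup (B × ℤ)} {k : ℕ}
    (hk : L.map (AddMonoidHom.snd B ℤ) = AddSubgroup.zmultiples (k : ℤ)) {b : B}
    (hb : (b, (k : ℤ)) ∈ L) : extSub (L.comap (AddMonoidHom.inl B ℤ)) b k = L := by
  ext ⟨c, z⟩
  constructor
  · rintro ⟨q, hq, h⟩
    have := L.add_mem h (L.zsmul_mem hb q)
    simp only at hq h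
    subst hq
    simpa using this
  · intro h
    have hz : z ∈ AddSubgroup.zmultiples (k : ℤ) := hk ▸ ⟨_, h, rfl⟩
    obtain ⟨q, rfl⟩ := AddSubgroup.mem_zmultiples_iff.1 hz
    refine ⟨q, by simp, ?_⟩
    have := L.sub_mem h (L.zsmul_mem hb q)
    simpa using this

/-- The cosets of `H` over which an invariant subgroup of `B × ℤ` with trace `H` and projection `kℤ`
can be built: the solutions `x` in `B ⧸ H` of `(β - ε) x = -k u`. -/
def ExtSol (β : B →+ B) (u : B) (ε : ℤ) (H : AddSubgroup B) (k : ℕ) : Type _ :=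
  {x : B ⧸ H // ∀ b : B, (b : B ⧸ H) = x → β b - ε • b + k • u ∈ H}

/-- The endomorphism `β - ε`. -/
def subSmul (β : B →+ B) (ε : ℤ) : B →+ B := β - (DistribSMul.toAddMonoidHom B ε)

@[simp] lemma subSmul_apply (β : B →+ B) (ε : ℤ) (b : B) : subSmul β ε b = β b - ε • b := rfl

lemma exists_zmultiples_natCast (K : AddSubgroup ℤ) :
    K = AddSubgroup.zmultiples (K.index : ℤ) := by
  obtain ⟨a, rfl⟩ := Int.subgroup_cyclic K
  rw [← AddSubgroup.zmultiples_eq_closure, Int.index_zmultiples, Int.zmultiples_natAbs]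

/-- The subgroup of `B × ℤ` made from a trace, a projection and a coset. -/
noncomputable def extToFun (β : B →+ B) (u : B) (ε : ℤ) {n : ℕ} (hn : n ≠ 0) :
    (Σ p : n.divisorsAntidiagonal, Σ H : InvSub β p.1.2, ExtSol β u ε H.1 p.1.1) →
      InvSub (extEnd β u ε) n :=
  fun s => ⟨extSub s.2.1.1 s.2.2.1.out s.1.1.1, by
    obtain ⟨⟨⟨k, m⟩, hp⟩, ⟨H, hH, hHβ⟩, ⟨x, hx⟩⟩ := s
    obtain ⟨rfl, -⟩ := Nat.mem_divisorsAntidiagonal.1 hp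
    rw [index_extSub (left_ne_zero_of_mul hn)]
    exact ⟨by simp only [hH], extSub_invariant hHβ (hx _ (QuotientAddGroup.out_eq' x))⟩⟩

lemma extToFun_bijective (β : B →+ B) (u : B) (ε : ℤ) {n : ℕ} (hn : n ≠ 0) :
    Function.Bijective (extToFun β u ε hn) := by
  constructor
  · rintro ⟨⟨⟨k, m⟩, hp⟩, ⟨H, hH, hHβ⟩, ⟨x, hx⟩⟩ ⟨⟨⟨k', m'⟩, hp'⟩, ⟨H', hH', hHβ'⟩, ⟨x', hx'⟩⟩ h
    replace h : extSub H x.out k = extSub H' x'.out k' := congrArg Subtype.val h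
    obtain ⟨hkm, -⟩ := Nat.mem_divisorsAntidiagonal.1 hp
    obtain ⟨hkm', -⟩ := Nat.mem_divisorsAntidiagonal.1 hp'
    simp only at hkm hkm' hH hH'
    have hk : k ≠ 0 := by rintro rfl; simp at hkm; exact hn hkm.symm
    have hk' : k' ≠ 0 := by rintro rfl; simp at hkm'; exact hn hkm'.symm
    obtain rfl : k = k' := by
      have := congrArg (fun L => (AddSubgroup.map (AddMonoidHom.snd B ℤ) L).index) h
      simpa [extSub_map_snd, Int.index_zmultiples] using this
    obtain rfl : H = H' := by
      have := congrArg (AddSubgroup.comap (AddMonoidHom.inl B ℤ)) h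
      rwa [extSub_comap_inl hk, extSub_comap_inl hk] at this
    obtain rfl : m = m' := hH.symm.trans hH'
    obtain rfl : x = x' := by
      have h1 := gen_mem_extSub H x.out k
      rw [h] at h1
      obtain ⟨q, hq, h2⟩ := h1
      have : q = 1 := by
        have : (k : ℤ) ≠ 0 := by exact_mod_cast hk
        simp only at hq
        exact mul_right_cancel₀ this (by rw [← hq, one_mul])
      subst this
      rw [← QuotientAddGroup.out_eq' x, ← QuotientAddGroup.out_eq' x', eq_comm,
        QuotientAddGroup.eq]
      simpa [neg_add_eq_sub] using h2
    rfl
  · rintro ⟨L, hL, hLα⟩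
    have hLi := index_eq_map_snd_mul L
    set k := (L.map (AddMonoidHom.snd B ℤ)).index with hk
    set H := L.comap (AddMonoidHom.inl B ℤ) with hH
    have hmap := exists_zmultiples_natCast (L.map (AddMonoidHom.snd B ℤ))
    rw [← hk] at hmap
    have hmem : (k : ℤ) ∈ L.map (AddMonoidHom.snd B ℤ) := hmap ▸ AddSubgroup.mem_zmultiples _
    obtain ⟨⟨b, _⟩, hb, rfl⟩ := hmem
    change (b, (k : ℤ)) ∈ L at hb
    have hHβ : ∀ a ∈ H, β a ∈ H := by
      intro a ha
      have := hLα _ ha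
      simpa [hH] using this
    have hsol : ∀ c : B, (c, (k : ℤ)) ∈ L → β c - ε • c + k • u ∈ H := by
      intro c hc
      have := L.sub_mem (hLα _ hc) (L.zsmul_mem hc ε)
      simp only [hH, AddSubgroup.mem_comap, AddMonoidHom.inl_apply]
      convert this using 1
      simp only [extEnd_apply, Prod.smul_mk, Prod.mk_sub_mk, natCast_zsmul, smul_eq_mul, sub_self,
        Prod.mk.injEq, and_true]
      abel
    have hout : ∀ c : B, (c : B ⧸ H) = (b : B ⧸ H) → (c, (k : ℤ)) ∈ L := by
      intro c hc
      rw [eq_comm, QuotientAddGroup.eq] at hc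
      have := L.add_mem hb hc
      simpa using this
    refine ⟨⟨⟨(k, H.index), Nat.mem_divisorsAntidiagonal.2 ⟨by rw [← hLi, hL], hn⟩⟩,
      ⟨H, rfl, hHβ⟩, ⟨(b : B ⧸ H), fun c hc => hsol c (hout c hc)⟩⟩, Subtype.ext ?_⟩
    exact eq_extSub hmap (hout _ (QuotientAddGroup.out_eq' _))

/-- Invariant subgroups of `B × ℤ` are classified by their trace `H` on `B`, their projection `kℤ`
and a solution of `(β - ε) x = -k u` in `B ⧸ H`. -/
noncomputable def extEquiv (β : B →+ B) (u : B) (ε : ℤ) {n : ℕ} (hn : n ≠ 0) :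
    (Σ p : n.divisorsAntidiagonal, Σ H : InvSub β p.1.2, ExtSol β u ε H.1 p.1.1) ≃
      InvSub (extEnd β u ε) n :=
  Equiv.ofBijective _ (extToFun_bijective β u ε hn)

lemma extEquiv_map_snd_index (β : B →+ B) (u : B) (ε : ℤ) {n : ℕ} (hn : n ≠ 0)
    (s : Σ p : n.divisorsAntidiagonal, Σ H : InvSub β p.1.2, ExtSol β u ε H.1 p.1.1) :
    ((extEquiv β u ε hn s).1.map (AddMonoidHom.snd B ℤ)).index = s.1.1.1 := by
  change ((extSub _ _ _).map _).index = _
  rw [extSub_map_snd, Int.index_zmultiples, Int.natAbs_natCast]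

lemma finite_extSol (β : B →+ B) (u : B) (ε : ℤ) {H : AddSubgroup B} (hH : H.index ≠ 0) (k : ℕ) :
    Finite (ExtSol β u ε H k) := by
  have := AddSubgroup.index_ne_zero_iff_finite.1 hH
  exact Subtype.finite

lemma finite_invSub_extEnd {β : B →+ B} (hβ : ∀ m : ℕ, m ≠ 0 → Finite (InvSub β m)) (u : B) (ε : ℤ)
    {n : ℕ} (hn : n ≠ 0) : Finite (InvSub (extEnd β u ε) n) := by
  have h1 : ∀ p : n.divisorsAntidiagonal,
      Finite (Σ H : InvSub β p.1.2, ExtSol β u ε H.1 p.1.1) := by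
    rintro ⟨⟨k, m⟩, hp⟩
    obtain ⟨rfl, -⟩ := Nat.mem_divisorsAntidiagonal.1 hp
    have hm : m ≠ 0 := right_ne_zero_of_mul hn
    have := hβ m hm
    have : ∀ H : InvSub β m, Finite (ExtSol β u ε H.1 k) :=
      fun H => finite_extSol β u ε (by rw [H.2.1]; exact hm) k
    infer_instance
  exact Finite.of_equiv _ (extEquiv β u ε hn)

open Classical in
/-- The equation `(β - ε) x = -k u` in `B ⧸ H` is solvable if and only if `k u` lies in
`H + (β - ε) B`, and then its solutions form a coset of the kernel of `β - ε` on the finite group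
`B ⧸ H`, which is as large as the cokernel. -/
lemma card_extSol {β : B →+ B} (u : B) (ε : ℤ) {H : AddSubgroup B} (hH : H.index ≠ 0)
    (hHβ : ∀ a ∈ H, β a ∈ H) (k : ℕ) :
    Nat.card (ExtSol β u ε H k) =
      if k • u ∈ H ⊔ (subSmul β ε).range then (H ⊔ (subSmul β ε).range).index else 0 := by
  have := AddSubgroup.index_ne_zero_iff_finite.1 hH
  have hle : H ≤ H.comap (subSmul β ε) := fun a ha => H.sub_mem (hHβ a ha) (H.zsmul_mem ha ε)
  set f : B ⧸ H →+ B ⧸ H := QuotientAddGroup.map H H (subSmul β ε) hle with hf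
  have hrange : f.range.comap (QuotientAddGroup.mk' H) = H ⊔ (subSmul β ε).range := by
    have : f.range = (subSmul β ε).range.map (QuotientAddGroup.mk' H) := by
      ext y
      constructor
      · rintro ⟨x, rfl⟩
        obtain ⟨b, rfl⟩ := QuotientAddGroup.mk_surjective x
        exact ⟨_, ⟨b, rfl⟩, rfl⟩
      · rintro ⟨_, ⟨b, rfl⟩, rfl⟩
        exact ⟨(b : B ⧸ H), rfl⟩
    rw [this, AddSubgroup.comap_map_eq, QuotientAddGroup.ker_mk', sup_comm]
  have hidx : (H ⊔ (subSmul β ε).range).index = Nat.card f.ker := by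
    rw [← hrange, AddSubgroup.index_comap_of_surjective _ (QuotientAddGroup.mk'_surjective H),
      AddSubgroup.index_range]
  have hmem : k • u ∈ H ⊔ (subSmul β ε).range ↔ ∃ x, f x = -((k • u : B) : B ⧸ H) := by
    rw [← hrange, AddSubgroup.mem_comap, ← neg_mem_iff]
    rfl
  have hsol : ∀ x : B ⧸ H, (∀ b : B, (b : B ⧸ H) = x → β b - ε • b + k • u ∈ H) ↔
      f x = -((k • u : B) : B ⧸ H) := by
    intro x
    obtain ⟨b, rfl⟩ := QuotientAddGroup.mk_surjective x
    have key : ∀ c : B, β c - ε • c + k • u ∈ H ↔ f c = -((k • u : B) : B ⧸ H) := by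
      intro c
      rw [← QuotientAddGroup.eq_zero_iff, eq_neg_iff_add_eq_zero]
      rfl
    constructor
    · intro h
      exact (key b).1 (h b rfl)
    · intro h c hc
      rw [key, hc, h]
  have hcard : Nat.card (ExtSol β u ε H k) = Nat.card {x // f x = -((k • u : B) : B ⧸ H)} :=
    Nat.card_congr (Equiv.subtypeEquivRight hsol)
  rw [hcard]
  split_ifs with h
  · obtain ⟨x₀, hx₀⟩ := hmem.1 h
    rw [hidx]
    refine Nat.card_congr ((Equiv.subRight x₀).subtypeEquiv fun x => ?_)
    rw [AddMonoidHom.mem_ker, Equiv.subRight_apply, map_sub, hx₀, sub_eq_zero]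
  · rw [Nat.card_eq_zero]
    left
    exact ⟨fun x => h (hmem.2 ⟨x.1, x.2⟩)⟩

/-- The number of invariant subgroups of `B × ℤ` as a sum over their traces and projections. -/
lemma invCount_extEnd {β : B →+ B} (hβ : ∀ m : ℕ, m ≠ 0 → Finite (InvSub β m)) (u : B) (ε : ℤ)
    {n : ℕ} (hn : n ≠ 0) :
    invCount (extEnd β u ε) n = ∑ p ∈ n.divisorsAntidiagonal,
      Nat.card (Σ H : InvSub β p.2, ExtSol β u ε H.1 p.1) := by
  have h1 : ∀ p : n.divisorsAntidiagonal,
      Finite (Σ H : InvSub β p.1.2, ExtSol β u ε H.1 p.1.1) := by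
    rintro ⟨⟨k, m⟩, hp⟩
    obtain ⟨rfl, -⟩ := Nat.mem_divisorsAntidiagonal.1 hp
    have hm : m ≠ 0 := right_ne_zero_of_mul hn
    have := hβ m hm
    have : ∀ H : InvSub β m, Finite (ExtSol β u ε H.1 k) :=
      fun H => finite_extSol β u ε (by rw [H.2.1]; exact hm) k
    infer_instance
  rw [invCount, ← Nat.card_congr (extEquiv β u ε hn), Nat.card_sigma,
    ← Finset.sum_coe_sort n.divisorsAntidiagonal
      (fun p => Nat.card (Σ H : InvSub β p.2, ExtSol β u ε H.1 p.1))]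

end Ext

/-- Conjugate endomorphisms have the same invariant subgroups, up to transport. -/
def invSubCongr {A A' : Type*} [AddCommGroup A] [AddCommGroup A'] {α : A →+ A} {α' : A' →+ A'}
    (e : A ≃+ A') (he : ∀ a, e (α a) = α' (e a)) (n : ℕ) : InvSub α n ≃ InvSub α' n where
  toFun H := ⟨H.1.comap e.symm.toAddMonoidHom, by
    rw [AddSubgroup.index_comap_of_surjective _ e.symm.surjective]
    refine ⟨H.2.1, fun a ha => ?_⟩
    have h := H.2.2 _ ha
    change e.symm (α' a) ∈ H.1
    have : e.symm (α' a) = α (e.symm a) := by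
      rw [AddEquiv.symm_apply_eq, he, AddEquiv.apply_symm_apply]
    rwa [this]⟩
  invFun H := ⟨H.1.comap e.toAddMonoidHom, by
    rw [AddSubgroup.index_comap_of_surjective _ e.surjective]
    refine ⟨H.2.1, fun a ha => ?_⟩
    have h := H.2.2 _ ha
    change e (α a) ∈ H.1
    rwa [he]⟩
  left_inv H := by
    apply Subtype.ext
    ext a
    simp
  right_inv H := by
    apply Subtype.ext
    ext a
    simp

lemma invCount_congr {A A' : Type*} [AddCommGroup A] [AddCommGroup A'] {α : A →+ A} {α' : A' →+ A'}
    (e : A ≃+ A') (he : ∀ a, e (α a) = α' (e a)) (n : ℕ) : invCount α n = invCount α' n :=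
  Nat.card_congr (invSubCongr e he n)

/-! ### Convolution of sequences -/

/-- The sequence with a single entry `1`, at `p`; its Dirichlet series is `p ^ (-s)`. -/
def deltaSeq (p : ℕ) : ArithmeticFunction ℤ :=
  ⟨fun n => if n = 0 then 0 else if n = p then 1 else 0, by simp⟩

lemma deltaSeq_apply {p n : ℕ} (hn : n ≠ 0) : deltaSeq p n = if n = p then 1 else 0 := by
  change (if n = 0 then 0 else if n = p then 1 else 0 : ℤ) = _
  rw [if_neg hn]

lemma oneSeq_apply {n : ℕ} (hn : n ≠ 0) : oneSeq n = 1 := if_neg hn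

lemma natSeq_apply (n : ℕ) : natSeq n = n := rfl

lemma sqSeq_apply (n : ℕ) : sqSeq n = (n : ℤ) ^ 2 := rfl

/-- Convolution with `deltaSeq p` shifts a sequence to the multiples of `p`. -/
lemma deltaSeq_mul_apply (p : ℕ) (f : ArithmeticFunction ℤ) {n : ℕ} (hn : n ≠ 0) :
    (deltaSeq p * f) n = if p ∣ n then f (n / p) else 0 := by
  rw [ArithmeticFunction.mul_apply]
  have h : ∀ x ∈ n.divisorsAntidiagonal,
      deltaSeq p x.1 * f x.2 = if x.1 = p then f (n / p) else 0 := by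
    rintro ⟨a, b⟩ hx
    obtain ⟨rfl, -⟩ := Nat.mem_divisorsAntidiagonal.1 hx
    have ha : a ≠ 0 := left_ne_zero_of_mul hn
    rw [deltaSeq_apply ha]
    split_ifs with h
    · rw [← h, one_mul, Nat.mul_div_cancel_left _ (Nat.pos_of_ne_zero ha)]
    · rw [zero_mul]
  rw [Finset.sum_congr rfl h]
  split_ifs with hp
  · obtain ⟨m, rfl⟩ := hp
    rw [Finset.sum_eq_single (p, m)]
    · simp
    · rintro ⟨a, b⟩ hx hne
      obtain ⟨hab, -⟩ := Nat.mem_divisorsAntidiagonal.1 hx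
      refine if_neg ?_
      rintro rfl
      exact hne (Prod.ext rfl
        (Nat.eq_of_mul_eq_mul_left (Nat.pos_of_ne_zero (left_ne_zero_of_mul hn)) hab))
    · intro h
      exact absurd (Nat.mem_divisorsAntidiagonal.2 ⟨rfl, hn⟩) h
  · refine Finset.sum_eq_zero fun x hx => if_neg ?_
    rintro rfl
    exact hp ⟨x.2, (Nat.mem_divisorsAntidiagonal.1 hx).1.symm⟩

lemma natCast_mul_apply (c : ℕ) (f : ArithmeticFunction ℤ) (n : ℕ) :
    ((c : ArithmeticFunction ℤ) * f) n = c * f n := by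
  induction c with
  | zero => simp
  | succ c ih => rw [Nat.cast_succ, add_mul, ArithmeticFunction.add_apply, ih]; simp [add_mul]

lemma finiteSeq_apply (l : List ℤ) {n : ℕ} (hn : n ≠ 0) : finiteSeq l n = l.getD (n - 1) 0 :=
  if_neg hn

lemma ArithmeticFunction.sub_apply' (f g : ArithmeticFunction ℤ) (n : ℕ) :
    (f - g) n = f n - g n := by
  rw [sub_eq_add_neg, sub_eq_add_neg, ArithmeticFunction.add_apply]
  rfl

lemma deltaSeq_mul_deltaSeq (p q : ℕ) (hp : p ≠ 0) :
    deltaSeq p * deltaSeq q = deltaSeq (p * q) := by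
  ext n
  rcases eq_or_ne n 0 with rfl | hn
  · simp
  rw [deltaSeq_mul_apply p _ hn, deltaSeq_apply hn]
  split_ifs with h1 h2 h2
  · rw [h2, Nat.mul_div_cancel_left _ (Nat.pos_of_ne_zero hp), deltaSeq_apply, if_pos rfl]
    rintro rfl
    exact hn (by simpa using h2)
  · obtain ⟨m, rfl⟩ := h1
    rw [Nat.mul_div_cancel_left _ (Nat.pos_of_ne_zero hp), deltaSeq_apply (right_ne_zero_of_mul hn),
      if_neg]
    rintro rfl
    exact h2 rfl
  · exact absurd ⟨q, h2⟩ h1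
  · rfl

lemma finiteSeq_two_eq (c : ℕ) :
    finiteSeq [1, -1, 0, (c : ℤ)] =
      1 - deltaSeq 2 + (c : ArithmeticFunction ℤ) * (deltaSeq 2 * deltaSeq 2) := by
  rw [deltaSeq_mul_deltaSeq 2 2 two_ne_zero]
  ext n
  rcases eq_or_ne n 0 with rfl | hn
  · simp
  rw [finiteSeq_apply _ hn, ArithmeticFunction.add_apply, ArithmeticFunction.sub_apply',
    natCast_mul_apply, deltaSeq_apply hn, deltaSeq_apply hn, ArithmeticFunction.one_apply]
  obtain ⟨n, rfl⟩ := Nat.exists_eq_succ_of_ne_zero hn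
  match n with
  | 0 | 1 | 2 | 3 => simp
  | n + 4 => simp

lemma finiteSeq_three_eq :
    finiteSeq [1, 0, -1, 0, 0, 0, 0, 0, 3] =
      1 - deltaSeq 3 + ((3 : ℕ) : ArithmeticFunction ℤ) * (deltaSeq 3 * deltaSeq 3) := by
  rw [deltaSeq_mul_deltaSeq 3 3 three_ne_zero]
  ext n
  rcases eq_or_ne n 0 with rfl | hn
  · simp
  rw [finiteSeq_apply _ hn, ArithmeticFunction.add_apply, ArithmeticFunction.sub_apply',
    natCast_mul_apply, deltaSeq_apply hn, deltaSeq_apply hn, ArithmeticFunction.one_apply]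
  obtain ⟨n, rfl⟩ := Nat.exists_eq_succ_of_ne_zero hn
  match n with
  | 0 | 1 | 2 | 3 | 4 | 5 | 6 | 7 | 8 => simp
  | n + 9 => simp

/-! ### Sublattices of `ℤ`, `ℤ²` and `ℤ³` -/

lemma invSub_int_eq {c : ℤ} {j : ℕ} (H : InvSub (AddMonoidHom.mulLeft c) j) :
    H.1 = AddSubgroup.zmultiples (j : ℤ) := by
  rw [exists_zmultiples_natCast H.1, H.2.1]

/-- `ℤ` has exactly one subgroup of each index, and it is invariant under multiplications. -/
@[reducible] def invSubIntUnique (c : ℤ) (j : ℕ) : Unique (InvSub (AddMonoidHom.mulLeft c) j) where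
  default := ⟨AddSubgroup.zmultiples (j : ℤ), by simp [Int.index_zmultiples], fun a ha => by
    rw [Int.mem_zmultiples_iff] at ha ⊢
    exact ha.mul_left c⟩
  uniq H := Subtype.ext (invSub_int_eq H)

lemma finite_invSub_int (c : ℤ) (j : ℕ) : Finite (InvSub (AddMonoidHom.mulLeft c) j) :=
  have := invSubIntUnique c j
  inferInstance

lemma invCount_int (c : ℤ) (j : ℕ) : invCount (AddMonoidHom.mulLeft c) j = 1 :=
  have := invSubIntUnique c j
  Nat.card_unique

section Trivial

variable {B : Type*} [AddCommGroup B]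

lemma extEnd_id : extEnd (AddMonoidHom.id B) 0 1 = AddMonoidHom.id (B × ℤ) := by
  ext <;> simp

/-- A subgroup of `B × ℤ` with trace `H` on `B` is determined by its projection and any element of
`B ⧸ H`. -/
lemma invCount_id_prod (hB : ∀ m : ℕ, m ≠ 0 → Finite (InvSub (AddMonoidHom.id B) m)) {n : ℕ}
    (hn : n ≠ 0) :
    invCount (AddMonoidHom.id (B × ℤ)) n =
      ∑ p ∈ n.divisorsAntidiagonal, p.2 * invCount (AddMonoidHom.id B) p.2 := by
  rw [← extEnd_id, invCount_extEnd hB 0 1 hn]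
  refine Finset.sum_congr rfl ?_
  rintro ⟨k, m⟩ hp
  obtain ⟨rfl, -⟩ := Nat.mem_divisorsAntidiagonal.1 hp
  have hm : m ≠ 0 := right_ne_zero_of_mul hn
  have := hB m hm
  have := Fintype.ofFinite (InvSub (AddMonoidHom.id B) m)
  have : ∀ H : InvSub (AddMonoidHom.id B) m, Finite (ExtSol (AddMonoidHom.id B) 0 1 H.1 k) :=
    fun H => finite_extSol _ _ _ (by rw [H.2.1]; exact hm) k
  have hr : (subSmul (AddMonoidHom.id B) 1).range = ⊥ := by
    rw [AddMonoidHom.range_eq_bot_iff]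
    ext b
    simp
  rw [Nat.card_sigma, Finset.sum_congr rfl (g := fun _ => m), Finset.sum_const, Finset.card_univ,
    ← Nat.card_eq_fintype_card, smul_eq_mul, mul_comm]
  · rfl
  intro H _
  rw [card_extSol 0 1 (by rw [H.2.1]; exact hm) H.2.2 k, if_pos (by simp), hr, sup_bot_eq, H.2.1]

lemma finite_invSub_id_prod (hB : ∀ m : ℕ, m ≠ 0 → Finite (InvSub (AddMonoidHom.id B) m)) (n : ℕ)
    (hn : n ≠ 0) : Finite (InvSub (AddMonoidHom.id (B × ℤ)) n) := by
  rw [← extEnd_id]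
  exact finite_invSub_extEnd hB 0 1 hn

end Trivial

lemma mulLeft_one_eq : AddMonoidHom.mulLeft (1 : ℤ) = AddMonoidHom.id ℤ := by
  ext; simp

lemma invCount_id_int_prod {n : ℕ} (hn : n ≠ 0) :
    (invCount (AddMonoidHom.id (ℤ × ℤ)) n : ℤ) = (oneSeq * natSeq) n := by
  rw [invCount_id_prod (fun m _ => mulLeft_one_eq ▸ finite_invSub_int 1 m) hn,
    ArithmeticFunction.mul_apply, Nat.cast_sum]
  refine Finset.sum_congr rfl fun p hp => ?_
  rw [oneSeq_apply (Nat.ne_zero_of_mem_divisorsAntidiagonal hp).1, natSeq_apply, ← mulLeft_one_eq,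
    invCount_int]
  simp

lemma finite_invSub_id_int_prod (n : ℕ) (hn : n ≠ 0) :
    Finite (InvSub (AddMonoidHom.id (ℤ × ℤ)) n) :=
  finite_invSub_id_prod (fun m _ => mulLeft_one_eq ▸ finite_invSub_int 1 m) n hn

lemma finite_invSub_id_int_prod_prod (n : ℕ) (hn : n ≠ 0) :
    Finite (InvSub (AddMonoidHom.id ((ℤ × ℤ) × ℤ)) n) :=
  finite_invSub_id_prod finite_invSub_id_int_prod n hn

/-- The number of sublattices of index `n` in a lattice of rank three. -/
lemma invCount_id_int_prod_prod {n : ℕ} (hn : n ≠ 0) :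
    (invCount (AddMonoidHom.id ((ℤ × ℤ) × ℤ)) n : ℤ) = (oneSeq * natSeq * sqSeq) n := by
  rw [invCount_id_prod finite_invSub_id_int_prod hn, mul_assoc,
    ArithmeticFunction.mul_apply, Nat.cast_sum]
  refine Finset.sum_congr rfl fun p hp => ?_
  obtain ⟨h1, h2⟩ := Nat.ne_zero_of_mem_divisorsAntidiagonal hp
  rw [oneSeq_apply h1, one_mul, Nat.cast_mul, invCount_id_int_prod h2,
    ArithmeticFunction.mul_apply, ArithmeticFunction.mul_apply, Finset.mul_sum]
  refine Finset.sum_congr rfl fun q hq => ?_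
  rw [oneSeq_apply (Nat.ne_zero_of_mem_divisorsAntidiagonal hq).1, natSeq_apply, natSeq_apply,
    sqSeq_apply, ← (Nat.mem_divisorsAntidiagonal.1 hq).1]
  push_cast
  ring

lemma finite_invSub_of_id {A : Type*} [AddCommGroup A] (α : A →+ A) {n : ℕ}
    (h : Finite (InvSub (AddMonoidHom.id A) n)) : Finite (InvSub α n) := by
  let f : InvSub α n → InvSub (AddMonoidHom.id A) n := fun H => ⟨H.1, H.2.1, fun _ ha => ha⟩
  exact Finite.of_injective f fun H H' h =>
    Subtype.ext (congrArg (fun K : InvSub (AddMonoidHom.id A) n => K.1) h)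

/-! ### Exchanges of two coordinates -/

section Reflection

/-- `j ℤ + 2 ℤ` is `ℤ` if `j` is odd and `2 ℤ` if `j` is even. -/
lemma card_extSol_int {u ε : ℤ} (hu : IsUnit u) (hε : IsUnit ε) {j : ℕ} (hj : j ≠ 0) (h : ℕ) :
    Nat.card (ExtSol (AddMonoidHom.mulLeft (-ε)) u ε (AddSubgroup.zmultiples (j : ℤ)) h) =
      if 2 ∣ j then (if 2 ∣ h then 2 else 0) else 1 := by
  have hidx : (AddSubgroup.zmultiples (j : ℤ)).index = j := by simp [Int.index_zmultiples]
  have hr : (subSmul (AddMonoidHom.mulLeft (-ε)) ε).range = AddSubgroup.zmultiples (2 : ℤ) := by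
    ext x
    rw [Int.mem_zmultiples_iff]
    constructor
    · rintro ⟨y, rfl⟩
      exact ⟨-ε * y, by simp; ring⟩
    · rintro ⟨y, rfl⟩
      refine ⟨-ε * y, ?_⟩
      have := Int.isUnit_mul_self hε
      simp only [subSmul_apply, AddMonoidHom.coe_mulLeft, smul_eq_mul]
      linear_combination (2 * y) * this
  rw [card_extSol u ε (by rwa [hidx]) (fun a ha => by
    rw [Int.mem_zmultiples_iff] at ha ⊢
    exact ha.mul_left _) h, hr]
  by_cases h1 : 2 ∣ j
  · have hle : AddSubgroup.zmultiples (j : ℤ) ≤ AddSubgroup.zmultiples (2 : ℤ) := by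
      rw [AddSubgroup.zmultiples_le, Int.mem_zmultiples_iff]
      exact_mod_cast h1
    have hmem : h • u ∈ AddSubgroup.zmultiples (2 : ℤ) ↔ 2 ∣ h := by
      rw [Int.mem_zmultiples_iff, nsmul_eq_mul, IsUnit.dvd_mul_right hu]
      norm_cast
    simp only [sup_eq_right.2 hle, hmem, if_pos h1, Int.index_zmultiples]
    rfl
  · have htop : AddSubgroup.zmultiples (j : ℤ) ⊔ AddSubgroup.zmultiples (2 : ℤ) = ⊤ := by
      rw [AddSubgroup.eq_top_iff']
      intro x
      have hx : x = (x * j) + (x * (1 - j)) := by ring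
      rw [hx]
      refine AddSubgroup.add_mem_sup ?_ ?_
      · rw [Int.mem_zmultiples_iff]
        exact dvd_mul_left _ _
      · rw [Int.mem_zmultiples_iff]
        refine Dvd.dvd.mul_left ?_ _
        omega
    rw [htop, if_pos (AddSubgroup.mem_top _), if_neg h1, AddSubgroup.index_top]

/-- The endomorphism `(c, z) ↦ (-ε c + z u, ε z)` of `ℤ²`. For `ε` and `u` equal to `±1` it is
conjugate to the exchange of the two coordinates. -/
def swapEnd (u ε : ℤ) : ℤ × ℤ →+ ℤ × ℤ := extEnd (AddMonoidHom.mulLeft (-ε)) u ε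

lemma finite_invSub_swapEnd (u ε : ℤ) (n : ℕ) (hn : n ≠ 0) : Finite (InvSub (swapEnd u ε) n) :=
  finite_invSub_of_id _ (finite_invSub_id_int_prod n hn)

/-- The image of `β - ε` on `ℤ²` is `ℤ × 0`, so that the cokernel of `β - ε` modulo `H` has the
index of the second projection of `H` as its order. -/
lemma card_extSol_swapEnd {u ε : ℤ} (hu : IsUnit u) {H : AddSubgroup (ℤ × ℤ)} (hH : H.index ≠ 0)
    (hinv : ∀ a ∈ H, swapEnd u ε a ∈ H) (k : ℕ) :
    Nat.card (ExtSol (swapEnd u ε) 0 ε H k) = (H.map (AddMonoidHom.snd ℤ ℤ)).index := by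
  have hr : (subSmul (swapEnd u ε) ε).range = (AddMonoidHom.snd ℤ ℤ).ker := by
    ext ⟨x, y⟩
    rw [AddMonoidHom.mem_ker, AddMonoidHom.coe_snd]
    constructor
    · rintro ⟨⟨c, z⟩, h⟩
      have := congrArg Prod.snd h
      simp only [swapEnd, subSmul_apply, extEnd_apply, Prod.snd_sub, Prod.smul_snd, smul_eq_mul,
        sub_self] at this
      exact this.symm
    · rintro (rfl : y = 0)
      refine ⟨(0, x * u), ?_⟩
      have := Int.isUnit_mul_self hu
      ext
      · simp only [swapEnd, subSmul_apply, extEnd_apply, map_zero, smul_eq_mul, zero_add,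
          Prod.smul_mk, mul_zero, Prod.fst_sub, sub_zero]
        linear_combination x * this
      · simp [swapEnd]
  have hs : (AddMonoidHom.snd ℤ ℤ).range = ⊤ :=
    AddMonoidHom.range_eq_top.2 fun z => ⟨(0, z), rfl⟩
  rw [card_extSol 0 ε hH hinv k, if_pos (by simp), hr, AddSubgroup.index_map, hs,
    AddSubgroup.index_top, mul_one]

/-- The sum, over the sublattices of `ℤ²` of index `m` invariant under the exchange, of the indices
of their second projections. -/
lemma card_sigma_extSol_swapEnd {u ε : ℤ} (hu : IsUnit u) (hε : IsUnit ε) (k : ℕ) {m : ℕ}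
    (hm : m ≠ 0) :
    (Nat.card (Σ H : InvSub (swapEnd u ε) m, ExtSol (swapEnd u ε) 0 ε H.1 k) : ℤ) =
      (finiteSeq [1, -1, 0, 4] * oneSeq * natSeq) m := by
  have := finite_invSub_swapEnd u ε m hm
  have := Fintype.ofFinite (InvSub (swapEnd u ε) m)
  have hf : ∀ H : InvSub (swapEnd u ε) m, Finite (ExtSol (swapEnd u ε) 0 ε H.1 k) :=
    fun H => finite_extSol _ _ _ (by rw [H.2.1]; exact hm) k
  have hfib : ∀ p : m.divisorsAntidiagonal,
      Nat.card (Σ H : InvSub (AddMonoidHom.mulLeft (-ε)) p.1.2,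
        ExtSol (AddMonoidHom.mulLeft (-ε)) u ε H.1 p.1.1) =
      if 2 ∣ p.1.2 then (if 2 ∣ p.1.1 then 2 else 0) else 1 := by
    rintro ⟨⟨h, j⟩, hp⟩
    obtain ⟨rfl, -⟩ := Nat.mem_divisorsAntidiagonal.1 hp
    have hj : j ≠ 0 := right_ne_zero_of_mul hm
    have := invSubIntUnique (-ε) j
    have hf : ∀ H : InvSub (AddMonoidHom.mulLeft (-ε)) j,
        Finite (ExtSol (AddMonoidHom.mulLeft (-ε)) u ε H.1 h) :=
      fun H => finite_extSol _ _ _ (by rw [H.2.1]; exact hj) h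
    rw [Nat.card_sigma, Fintype.sum_unique, invSub_int_eq]
    exact card_extSol_int hu hε hj h
  have hfin : ∀ p : m.divisorsAntidiagonal,
      Finite (Σ H : InvSub (AddMonoidHom.mulLeft (-ε)) p.1.2,
        ExtSol (AddMonoidHom.mulLeft (-ε)) u ε H.1 p.1.1) := by
    rintro ⟨⟨h, j⟩, hp⟩
    obtain ⟨rfl, -⟩ := Nat.mem_divisorsAntidiagonal.1 hp
    have hj : j ≠ 0 := right_ne_zero_of_mul hm
    have := finite_invSub_int (-ε) j
    have hf : ∀ H : InvSub (AddMonoidHom.mulLeft (-ε)) j,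
        Finite (ExtSol (AddMonoidHom.mulLeft (-ε)) u ε H.1 h) :=
      fun H => finite_extSol _ _ _ (by rw [H.2.1]; exact hj) h
    exact inferInstanceAs (Finite (Σ H : InvSub (AddMonoidHom.mulLeft (-ε)) j,
        ExtSol (AddMonoidHom.mulLeft (-ε)) u ε H.1 h))
  have := fun p : m.divisorsAntidiagonal =>
    Fintype.ofFinite (Σ H : InvSub (AddMonoidHom.mulLeft (-ε)) p.1.2,
      ExtSol (AddMonoidHom.mulLeft (-ε)) u ε H.1 p.1.1)
  have hsum : Nat.card (Σ H : InvSub (swapEnd u ε) m, ExtSol (swapEnd u ε) 0 ε H.1 k) =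
      ∑ p ∈ m.divisorsAntidiagonal,
        p.1 * if 2 ∣ p.2 then (if 2 ∣ p.1 then 2 else 0) else 1 := by
    let e : (Σ p : m.divisorsAntidiagonal, Σ H : InvSub (AddMonoidHom.mulLeft (-ε)) p.1.2,
        ExtSol (AddMonoidHom.mulLeft (-ε)) u ε H.1 p.1.1) ≃ InvSub (swapEnd u ε) m :=
      extEquiv (AddMonoidHom.mulLeft (-ε)) u ε hm
    have he : ∀ s, ((e s).1.map (AddMonoidHom.snd ℤ ℤ)).index = s.1.1.1 :=
      extEquiv_map_snd_index (AddMonoidHom.mulLeft (-ε)) u ε hm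
    rw [Nat.card_sigma, Finset.sum_congr rfl fun H _ =>
      card_extSol_swapEnd hu (by rw [H.2.1]; exact hm) H.2.2 k,
      ← Equiv.sum_comp e, Finset.sum_congr rfl fun s _ => he s,
      Fintype.sum_sigma, ← Finset.sum_coe_sort m.divisorsAntidiagonal]
    refine Finset.sum_congr rfl fun p _ => ?_
    rw [← hfib p]
    refine (Finset.sum_const p.1.1).trans ?_
    rw [Finset.card_univ, ← Nat.card_eq_fintype_card, smul_eq_mul, mul_comm]
  have hseq : finiteSeq [1, -1, 0, 4] * oneSeq * natSeq =
      natSeq * (oneSeq - deltaSeq 2 * oneSeq) +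
        ((4 : ℕ) : ArithmeticFunction ℤ) * ((deltaSeq 2 * natSeq) * (deltaSeq 2 * oneSeq)) := by
    have := finiteSeq_two_eq 4
    rw [Nat.cast_ofNat] at this
    rw [this]
    ring
  rw [hsum, hseq, ArithmeticFunction.add_apply, natCast_mul_apply, ArithmeticFunction.mul_apply,
    ArithmeticFunction.mul_apply, Finset.mul_sum, ← Finset.sum_add_distrib, Nat.cast_sum]
  refine Finset.sum_congr rfl fun p hp => ?_
  obtain ⟨h1, h2⟩ := Nat.ne_zero_of_mem_divisorsAntidiagonal hp
  rw [ArithmeticFunction.sub_apply', deltaSeq_mul_apply _ _ h1, deltaSeq_mul_apply _ _ h2,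
    natSeq_apply, oneSeq_apply h2, natSeq_apply]
  by_cases hj : 2 ∣ p.2
  · have hj' : p.2 / 2 ≠ 0 := by omega
    by_cases hh : 2 ∣ p.1
    · obtain ⟨c, hc⟩ := hh
      simp only [hj, hc, if_true, oneSeq_apply hj', dvd_mul_right,
        Nat.mul_div_cancel_left _ two_pos]
      push_cast
      ring
    · simp [hj, hh, oneSeq_apply hj']
  · simp [hj]

/-- The number of sublattices of `ℤ² × ℤ` invariant under an exchange of the two coordinates of `ℤ²`
together with multiplication by `ε` on `ℤ`. -/
lemma invCount_swap {u ε : ℤ} (hu : IsUnit u) (hε : IsUnit ε) {n : ℕ} (hn : n ≠ 0) :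
    (invCount (extEnd (swapEnd u ε) 0 ε) n : ℤ) =
      (finiteSeq [1, -1, 0, 4] * oneSeq * oneSeq * natSeq) n := by
  have : finiteSeq [1, -1, 0, 4] * oneSeq * oneSeq * natSeq =
      oneSeq * (finiteSeq [1, -1, 0, 4] * oneSeq * natSeq) := by ring
  rw [this, invCount_extEnd (finite_invSub_swapEnd u ε) 0 ε hn, ArithmeticFunction.mul_apply,
    Nat.cast_sum]
  refine Finset.sum_congr rfl fun p hp => ?_
  obtain ⟨h1, h2⟩ := Nat.ne_zero_of_mem_divisorsAntidiagonal hp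
  rw [card_sigma_extSol_swapEnd hu hε p.1 h2, oneSeq_apply h1, one_mul]

end Reflection

/-! ### Extensions by a ring of quadratic integers -/

section Prime

variable {B : Type*} [AddCommGroup B]

/-- When `β - ε` is injective with image of index `p`, it maps the invariant subgroups of index
`m / p` bijectively to the invariant subgroups of index `m` that lie in its image. -/
lemma card_invSub_le_range {β : B →+ B} {ε : ℤ} {p : ℕ} (hp : p ≠ 0)
    (hinj : Function.Injective (subSmul β ε)) (hidx : (subSmul β ε).range.index = p) {m : ℕ}
    (hm : m ≠ 0) :
    Nat.card {H : InvSub β m // H.1 ≤ (subSmul β ε).range} =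
      if p ∣ m then invCount β (m / p) else 0 := by
  have hcomm : ∀ b, β (subSmul β ε b) = subSmul β ε (β b) := by
    intro b
    simp
  split_ifs with h
  · obtain ⟨c, rfl⟩ := h
    rw [Nat.mul_div_cancel_left _ (Nat.pos_of_ne_zero hp), invCount]
    refine Nat.card_congr
      { toFun := fun H => ⟨H.1.1.comap (subSmul β ε), ?_, ?_⟩
        invFun := fun H => ⟨⟨H.1.map (subSmul β ε), ?_, ?_⟩, ?_⟩
        left_inv := ?_
        right_inv := ?_ }
    · have h1 := AddSubgroup.relIndex_mul_index H.2
      rw [← AddSubgroup.index_comap, hidx, H.1.2.1, mul_comm] at h1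
      exact Nat.eq_of_mul_eq_mul_left (Nat.pos_of_ne_zero hp) h1
    · intro a ha
      rw [AddSubgroup.mem_comap] at ha ⊢
      rw [← hcomm]
      exact H.1.2.2 _ ha
    · rw [AddSubgroup.index_map_of_injective _ hinj, hidx, H.2.1, mul_comm]
    · rintro _ ⟨a, ha, rfl⟩
      exact ⟨β a, H.2.2 a ha, (hcomm a).symm⟩
    · rintro _ ⟨a, -, rfl⟩
      exact ⟨a, rfl⟩
    · intro H
      apply Subtype.ext
      apply Subtype.ext
      exact AddSubgroup.map_comap_eq_self H.2
    · intro H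
      apply Subtype.ext
      exact AddSubgroup.comap_map_eq_self_of_injective hinj _
  · rw [Nat.card_eq_zero]
    left
    refine ⟨fun H => h ?_⟩
    have := AddSubgroup.index_dvd_of_le H.2
    rwa [hidx, H.1.2.1] at this

/-- A subgroup either lies in the image of `β - ε`, which has prime index `p`, or generates `B`
together with it. -/
lemma card_extSol_prime {β : B →+ B} {ε : ℤ} {u : B} {p : ℕ} (hp : p.Prime)
    (hidx : (subSmul β ε).range.index = p) (hu : u ∉ (subSmul β ε).range) {H : AddSubgroup B}
    (hH : H.index ≠ 0) (hHβ : ∀ a ∈ H, β a ∈ H) (k : ℕ) [Decidable (H ≤ (subSmul β ε).range)] :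
    Nat.card (ExtSol β u ε H k) =
      if H ≤ (subSmul β ε).range then (if p ∣ k then p else 0) else 1 := by
  rw [card_extSol u ε hH hHβ k]
  set P := (subSmul β ε).range with hP
  by_cases h : H ≤ P
  · have hmem : k • u ∈ P ↔ p ∣ k := by
      have hpu : ∀ b : B, p • b ∈ P := fun b => by
        rw [← hidx]
        exact AddSubgroup.nsmul_index_mem P b
      constructor
      · intro hk
        by_contra hpk
        have hc : IsCoprime (k : ℤ) (p : ℤ) :=
          Nat.isCoprime_iff_coprime.2 (hp.coprime_iff_not_dvd.2 hpk).symm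
        obtain ⟨a, b, hab⟩ := hc
        apply hu
        have := P.add_mem (P.zsmul_mem hk a) (P.zsmul_mem (hpu u) b)
        rwa [← natCast_zsmul, ← natCast_zsmul, smul_smul, smul_smul, ← add_smul, hab, one_smul]
          at this
      · rintro ⟨c, rfl⟩
        rw [mul_smul]
        exact hpu _
    rw [sup_eq_right.2 h, if_pos h, hidx]
    simp only [hmem]
  · have htop : H ⊔ P = ⊤ := by
      have hdvd := AddSubgroup.index_dvd_of_le (le_sup_right : P ≤ H ⊔ P)
      rw [hidx, Nat.dvd_prime hp] at hdvd
      rcases hdvd with h1 | h1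
      · exact AddSubgroup.index_eq_one.1 h1
      · exfalso
        have h2 := AddSubgroup.relIndex_mul_index (le_sup_right : P ≤ H ⊔ P)
        rw [hidx, h1] at h2
        have h3 := Nat.eq_of_mul_eq_mul_right hp.pos (h2.trans (one_mul p).symm)
        exact h (le_sup_left.trans (AddSubgroup.relIndex_eq_one.1 h3))
    rw [htop, if_pos (AddSubgroup.mem_top _), if_neg h, AddSubgroup.index_top]

/-- An invariant sublattice with trace `H` contributes one for each projection `kℤ`, unless `H` lies
in `(β - ε) B`; then it contributes `p` if `p ∣ k`, and nothing otherwise. -/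
lemma invCount_extEnd_prime {β : B →+ B} {ε : ℤ} {u : B} {p : ℕ} (hp : p.Prime)
    (hβ : ∀ m : ℕ, m ≠ 0 → Finite (InvSub β m))
    (hinj : Function.Injective (subSmul β ε)) (hidx : (subSmul β ε).range.index = p)
    (hu : u ∉ (subSmul β ε).range) {r : ArithmeticFunction ℤ}
    (hr : ∀ m : ℕ, m ≠ 0 → r m = invCount β m) {n : ℕ} (hn : n ≠ 0) :
    (invCount (extEnd β u ε) n : ℤ) =
      ((1 - deltaSeq p + (p : ArithmeticFunction ℤ) * (deltaSeq p * deltaSeq p)) *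
        oneSeq * r) n := by
  classical
  have hseq : (1 - deltaSeq p + (p : ArithmeticFunction ℤ) * (deltaSeq p * deltaSeq p)) *
      oneSeq * r =
      oneSeq * (r - deltaSeq p * r) +
        (p : ArithmeticFunction ℤ) * ((deltaSeq p * oneSeq) * (deltaSeq p * r)) := by ring
  rw [hseq, invCount_extEnd hβ u ε hn, ArithmeticFunction.add_apply, natCast_mul_apply,
    ArithmeticFunction.mul_apply, ArithmeticFunction.mul_apply, Finset.mul_sum,
    ← Finset.sum_add_distrib, Nat.cast_sum]
  refine Finset.sum_congr rfl ?_
  rintro ⟨k, m⟩ hkm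
  obtain ⟨hk, hm⟩ : k ≠ 0 ∧ m ≠ 0 := Nat.ne_zero_of_mem_divisorsAntidiagonal hkm
  have := hβ m hm
  have := Fintype.ofFinite (InvSub β m)
  have hf : ∀ H : InvSub β m, Finite (ExtSol β u ε H.1 k) :=
    fun H => finite_extSol _ _ _ (by rw [H.2.1]; exact hm) k
  have hN : ((Finset.univ.filter fun H : InvSub β m => H.1 ≤ (subSmul β ε).range).card : ℤ) =
      (deltaSeq p * r) m := by
    rw [deltaSeq_mul_apply _ _ hm, ← Fintype.card_subtype, ← Nat.card_eq_fintype_card,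
      card_invSub_le_range hp.ne_zero hinj hidx hm]
    split_ifs with h
    · rw [hr _ (Nat.div_ne_zero_iff_of_dvd h |>.2 ⟨hm, hp.ne_zero⟩)]
    · rfl
  have hr' : r m = (Fintype.card (InvSub β m) : ℤ) := by
    rw [hr m hm, invCount, Nat.card_eq_fintype_card]
  have hcompl := Finset.card_filter_add_card_filter_not (s := (Finset.univ : Finset (InvSub β m)))
    (fun H => H.1 ≤ (subSmul β ε).range)
  rw [Finset.card_univ] at hcompl
  have hone : (deltaSeq p * oneSeq) k = if p ∣ k then 1 else 0 := by
    rw [deltaSeq_mul_apply _ _ hk]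
    split_ifs with h
    · rw [oneSeq_apply (Nat.div_ne_zero_iff_of_dvd h |>.2 ⟨hk, hp.ne_zero⟩)]
    · rfl
  rw [Nat.card_sigma, Finset.sum_congr rfl fun H _ =>
    card_extSol_prime hp hidx hu (by rw [H.2.1]; exact hm) H.2.2 k, Finset.sum_ite,
    Finset.sum_const, Finset.sum_const, ArithmeticFunction.sub_apply', hr', ← hcompl, ← hN,
    oneSeq_apply hk, hone]
  simp only [smul_eq_mul]
  split_ifs
  · push_cast
    ring
  · push_cast
    ring

end Prime

/-- Multiplication by a root `ζ` of `X² + c X + 1` on `ℤ ⊕ ℤ ζ`. -/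
def rootEnd (c : ℤ) : ℤ × ℤ →+ ℤ × ℤ where
  toFun v := (-v.2, v.1 - c * v.2)
  map_zero' := by simp
  map_add' v w := by ext <;> simp <;> ring

@[simp] lemma rootEnd_apply (c : ℤ) (v : ℤ × ℤ) : rootEnd c v = (-v.2, v.1 - c * v.2) := rfl

lemma finite_invSub_rootEnd (c : ℤ) (n : ℕ) (hn : n ≠ 0) : Finite (InvSub (rootEnd c) n) :=
  finite_invSub_of_id _ (finite_invSub_id_int_prod n hn)

/-- The vectors in `ℤ²` whose coordinate sum is divisible by `p` form a sublattice of index `p`. -/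
lemma index_range_and_notMem_range {f : ℤ × ℤ →+ ℤ × ℤ} {p : ℕ}
    (h : ∀ v, v ∈ f.range ↔ (p : ℤ) ∣ v.1 + v.2) :
    f.range.index = p ∧ (p ≠ 1 → ((1, 0) : ℤ × ℤ) ∉ f.range) := by
  let g : ℤ × ℤ →+ ℤ :=
    { toFun := fun v => v.1 + v.2
      map_zero' := by simp
      map_add' := fun v w => by simp; ring }
  have hg : f.range = (AddSubgroup.zmultiples (p : ℤ)).comap g := by
    ext v
    rw [h, AddSubgroup.mem_comap, Int.mem_zmultiples_iff]
    rfl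
  constructor
  · rw [hg, AddSubgroup.index_comap_of_surjective, Int.index_zmultiples, Int.natAbs_natCast]
    exact fun z => ⟨(z, 0), by simp [g]⟩
  · intro hp h1
    rw [h] at h1
    apply hp
    have h1 : (p : ℤ) ∣ 1 := by simpa using h1
    exact_mod_cast Int.eq_one_of_dvd_one (by positivity) h1

/-- Sublattices of an extension of `ℤ` by the Eisenstein integers invariant under a cubic root of
unity, in terms of those of the Eisenstein integers. -/
lemma invCount_extEnd_rootEnd_three {r : ArithmeticFunction ℤ}
    (hr : ∀ m : ℕ, m ≠ 0 → r m = invCount (rootEnd 1) m) {n : ℕ} (hn : n ≠ 0) :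
    (invCount (extEnd (rootEnd 1) (1, 0) 1) n : ℤ) =
      (finiteSeq [1, 0, -1, 0, 0, 0, 0, 0, 3] * oneSeq * r) n := by
  have h := index_range_and_notMem_range (f := subSmul (rootEnd 1) 1) (p := 3) (by
    rintro ⟨x, y⟩
    constructor
    · rintro ⟨⟨a, b⟩, hab⟩
      simp only [subSmul_apply, rootEnd_apply, one_smul, Prod.mk_sub_mk, Prod.mk.injEq] at hab
      simp only
      omega
    · rintro ⟨c, hc⟩
      refine ⟨(c - x, -c), ?_⟩
      simp only at hc
      simp only [subSmul_apply, rootEnd_apply, one_smul, Prod.mk_sub_mk, Prod.mk.injEq]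
      omega)
  rw [finiteSeq_three_eq]
  refine invCount_extEnd_prime Nat.prime_three (finite_invSub_rootEnd 1) ?_ h.1
    (h.2 (by norm_num)) hr hn
  rw [injective_iff_map_eq_zero]
  rintro ⟨a, b⟩ hab
  simp only [subSmul_apply, rootEnd_apply, one_smul, Prod.mk_sub_mk, Prod.mk_eq_zero] at hab ⊢
  omega

/-- Sublattices of an extension of `ℤ` by the Gaussian integers invariant under `(i, -1)`, in terms
of those of the Gaussian integers. -/
lemma invCount_extEnd_rootEnd_four {r : ArithmeticFunction ℤ}
    (hr : ∀ m : ℕ, m ≠ 0 → r m = invCount (rootEnd 0) m) {n : ℕ} (hn : n ≠ 0) :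
    (invCount (extEnd (rootEnd 0) (1, 0) (-1)) n : ℤ) =
      (finiteSeq [1, -1, 0, 2] * oneSeq * r) n := by
  have h := index_range_and_notMem_range (f := subSmul (rootEnd 0) (-1)) (p := 2) (by
    rintro ⟨x, y⟩
    constructor
    · rintro ⟨⟨a, b⟩, hab⟩
      simp only [subSmul_apply, rootEnd_apply, neg_smul, one_smul, sub_neg_eq_add, Prod.mk_add_mk,
        Prod.mk.injEq] at hab
      simp only
      omega
    · rintro ⟨c, hc⟩
      refine ⟨(c, c - x), ?_⟩
      simp only at hc
      simp only [subSmul_apply, rootEnd_apply, neg_smul, one_smul, sub_neg_eq_add, Prod.mk_add_mk,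
        Prod.mk.injEq]
      omega)
  have h2 := finiteSeq_two_eq 2
  rw [Nat.cast_ofNat] at h2
  rw [h2]
  refine invCount_extEnd_prime Nat.prime_two (finite_invSub_rootEnd 0) ?_ h.1
    (h.2 (by norm_num)) hr hn
  rw [injective_iff_map_eq_zero]
  rintro ⟨a, b⟩ hab
  simp only [subSmul_apply, rootEnd_apply, neg_smul, one_smul, sub_neg_eq_add, Prod.mk_add_mk,
    Prod.mk_eq_zero] at hab ⊢
  omega

/-! ### Ideals of quadratic cyclotomic fields -/

section IdealCount

variable (R : Type*) [CommRing R] [IsDedekindDomain R] [Module.Free ℤ R]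

/-- The number of ideals of norm `n`. -/
noncomputable def idealCount : ArithmeticFunction ℤ :=
  ⟨fun n => if n = 0 then 0 else Nat.card {I : Ideal R // Ideal.absNorm I = n}, by simp⟩

variable {R}

lemma idealCount_apply {n : ℕ} (hn : n ≠ 0) :
    idealCount R n = Nat.card {I : Ideal R // Ideal.absNorm I = n} := if_neg hn

lemma isCoprime_of_natCast_mem {R : Type*} [CommRing R] {I J : Ideal R} {m n : ℕ}
    (hm : (m : R) ∈ I) (hn : (n : R) ∈ J) (h : m.Coprime n) : IsCoprime I J := by
  rw [Ideal.isCoprime_iff_exists]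
  obtain ⟨a, b, hab⟩ := Nat.isCoprime_iff_coprime.2 h
  refine ⟨a * m, I.mul_mem_left _ hm, b * n, J.mul_mem_left _ hn, ?_⟩
  exact_mod_cast congrArg (Int.cast : ℤ → R) hab

/-- An ideal whose norm is a product of coprime integers `m` and `n` is the product of unique ideals
of norms `m` and `n`. -/
lemma mul_bijective_of_coprime [Module.Finite ℤ R] {m n : ℕ} (h : m.Coprime n) :
    Function.Bijective
      (fun p : {I : Ideal R // Ideal.absNorm I = m} × {I : Ideal R // Ideal.absNorm I = n} =>
        (⟨p.1.1 * p.2.1, by rw [map_mul, p.1.2, p.2.2]⟩ :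
          {I : Ideal R // Ideal.absNorm I = m * n})) := by
  have hmem : ∀ {I : Ideal R} {k : ℕ}, Ideal.absNorm I = k → (k : R) ∈ I := by
    rintro I k rfl
    exact Ideal.absNorm_mem I
  constructor
  · rintro ⟨⟨I, hI⟩, ⟨J, hJ⟩⟩ ⟨⟨I', hI'⟩, ⟨J', hJ'⟩⟩ heq
    have heq : I * J = I' * J' := congrArg Subtype.val heq
    have key : ∀ {I J I' J' : Ideal R} {m n : ℕ}, m.Coprime n → Ideal.absNorm I = m →
        Ideal.absNorm J' = n → I * J = I' * J' → I' ≤ I := by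
      intro I J I' J' m n h hI hJ' heq
      rw [← Ideal.dvd_iff_le]
      refine (isCoprime_of_natCast_mem (hmem hI) (hmem hJ') h).dvd_of_dvd_mul_right ?_
      rw [← heq]
      exact dvd_mul_right I J
    have h1 : I = I' := le_antisymm (key h hI' hJ heq.symm) (key h hI hJ' heq)
    have h2 : J = J' := by
      rw [mul_comm I, mul_comm I'] at heq
      exact le_antisymm (key h.symm hJ' hI heq.symm) (key h.symm hJ hI' heq)
    subst h1 h2
    rfl
  · rintro ⟨K, hK⟩
    set I := K ⊔ Ideal.span {(m : R)} with hI
    set J := K ⊔ Ideal.span {(n : R)} with hJ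
    have hmI : (m : R) ∈ I := Ideal.mem_sup_right (Ideal.mem_span_singleton_self _)
    have hnJ : (n : R) ∈ J := Ideal.mem_sup_right (Ideal.mem_span_singleton_self _)
    have hIJ : I * J = K := by
      apply le_antisymm
      · rw [hI, hJ, Ideal.sup_mul, Ideal.mul_sup, Ideal.mul_sup,
          Ideal.span_singleton_mul_span_singleton]
        refine sup_le (sup_le Ideal.mul_le_left Ideal.mul_le_left)
          (sup_le Ideal.mul_le_right ?_)
        rw [Ideal.span_singleton_le_iff_mem]
        exact_mod_cast hmem hK
      · rw [Ideal.mul_eq_inf_of_isCoprime (isCoprime_of_natCast_mem hmI hnJ h)]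
        exact le_inf le_sup_left le_sup_left
    have hN : Ideal.absNorm I * Ideal.absNorm J = m * n := by rw [← map_mul, hIJ, hK]
    have hIm : Ideal.absNorm I ∣ m ^ Module.finrank ℤ R := by
      rw [← Ideal.absNorm_span_natCast]
      exact Ideal.absNorm_dvd_absNorm_of_le le_sup_right
    have hJn : Ideal.absNorm J ∣ n ^ Module.finrank ℤ R := by
      rw [← Ideal.absNorm_span_natCast]
      exact Ideal.absNorm_dvd_absNorm_of_le le_sup_right
    have h1 : Ideal.absNorm I ∣ m := by
      refine Nat.Coprime.dvd_of_dvd_mul_right ?_ (Dvd.intro _ hN)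
      exact Nat.Coprime.coprime_dvd_left hIm (h.pow_left _)
    have h2 : Ideal.absNorm J ∣ n := by
      refine Nat.Coprime.dvd_of_dvd_mul_left ?_ (Dvd.intro_left _ hN)
      exact Nat.Coprime.coprime_dvd_left hJn (h.symm.pow_left _)
    have h3 : m ∣ Ideal.absNorm I := by
      refine Nat.Coprime.dvd_of_dvd_mul_right ?_ (Dvd.intro _ hN.symm)
      exact Nat.Coprime.coprime_dvd_right hJn (h.pow_right _)
    have h4 : n ∣ Ideal.absNorm J := by
      refine Nat.Coprime.dvd_of_dvd_mul_left ?_ (Dvd.intro_left _ hN.symm)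
      exact Nat.Coprime.coprime_dvd_right hIm (h.symm.pow_right _)
    exact ⟨⟨⟨I, Nat.dvd_antisymm h1 h3⟩, ⟨J, Nat.dvd_antisymm h2 h4⟩⟩, Subtype.ext hIJ⟩

lemma idealCount_isMultiplicative [Module.Finite ℤ R] : (idealCount R).IsMultiplicative := by
  rw [ArithmeticFunction.IsMultiplicative.iff_ne_zero]
  constructor
  · rw [idealCount_apply one_ne_zero]
    have : Unique {I : Ideal R // Ideal.absNorm I = 1} :=
      { default := ⟨⊤, Ideal.absNorm_top⟩
        uniq := fun I => Subtype.ext (Ideal.absNorm_eq_one_iff.1 I.2) }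
    rw [Nat.card_unique, Nat.cast_one]
  · intro m n hm hn h
    rw [idealCount_apply hm, idealCount_apply hn, idealCount_apply (mul_ne_zero hm hn),
      ← Nat.card_congr (Equiv.ofBijective _ (mul_bijective_of_coprime (R := R) h)), Nat.card_prod,
      Nat.cast_mul]

variable {p : ℕ}

lemma dvd_span_pow_of_absNorm {I : Ideal R} {k : ℕ} (hI : Ideal.absNorm I = p ^ k) :
    I ∣ Ideal.span {(p : R)} ^ k := by
  rw [Ideal.dvd_iff_le, Ideal.span_singleton_pow, Ideal.span_singleton_le_iff_mem]
  have := Ideal.absNorm_mem I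
  rw [hI] at this
  exact_mod_cast this

lemma idealCount_ramified (hp : p.Prime) {P : Ideal R} [P.IsPrime] (hP : Ideal.absNorm P = p)
    (h : Ideal.span {(p : R)} = P ^ 2) (k : ℕ) : idealCount R (p ^ k) = 1 := by
  have hP0 : P ≠ ⊥ := by
    rintro rfl
    exact hp.ne_zero (by rw [← hP, Ideal.absNorm_bot])
  rw [idealCount_apply (pow_ne_zero k hp.ne_zero)]
  have : Unique {I : Ideal R // Ideal.absNorm I = p ^ k} :=
    { default := ⟨P ^ k, by rw [map_pow, hP]⟩
      uniq := by
        rintro ⟨I, hI⟩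
        apply Subtype.ext
        have hdvd := dvd_span_pow_of_absNorm hI
        rw [h, ← pow_mul, dvd_prime_pow (Ideal.prime_of_isPrime hP0 ‹_›)] at hdvd
        obtain ⟨i, -, hi⟩ := hdvd
        rw [associated_iff_eq] at hi
        subst hi
        rw [map_pow, hP] at hI
        exact congrArg (P ^ ·) (Nat.pow_right_injective hp.two_le hI) }
  rw [Nat.card_unique, Nat.cast_one]

lemma idealCount_inert (hp : p.Prime) [(Ideal.span {(p : R)}).IsPrime]
    (hP : Ideal.absNorm (Ideal.span {(p : R)}) = p ^ 2) (k : ℕ) :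
    idealCount R (p ^ k) = if Even k then 1 else 0 := by
  have hP0 : Ideal.span {(p : R)} ≠ ⊥ := by
    intro h
    rw [h, Ideal.absNorm_bot] at hP
    exact pow_ne_zero 2 hp.ne_zero hP.symm
  have key : ∀ {I : Ideal R}, Ideal.absNorm I = p ^ k →
      ∃ i, I = Ideal.span {(p : R)} ^ i ∧ k = i + i := by
    intro I hI
    have hdvd := dvd_span_pow_of_absNorm hI
    rw [dvd_prime_pow (Ideal.prime_of_isPrime hP0 ‹_›)] at hdvd
    obtain ⟨i, -, hi⟩ := hdvd
    rw [associated_iff_eq] at hi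
    subst hi
    rw [map_pow, hP, ← pow_mul] at hI
    exact ⟨i, rfl, by rw [← Nat.pow_right_injective hp.two_le hI, two_mul]⟩
  rw [idealCount_apply (pow_ne_zero k hp.ne_zero)]
  split_ifs with hk
  · obtain ⟨i, rfl⟩ := hk
    have : Unique {I : Ideal R // Ideal.absNorm I = p ^ (i + i)} :=
      { default := ⟨Ideal.span {(p : R)} ^ i, by rw [map_pow, hP, ← pow_mul, two_mul]⟩
        uniq := by
          rintro ⟨I, hI⟩
          apply Subtype.ext
          obtain ⟨j, rfl, hj⟩ := key hI
          obtain rfl : i = j := by omega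
          rfl }
    rw [Nat.card_unique, Nat.cast_one]
  · rw [Nat.cast_eq_zero, Nat.card_eq_zero]
    left
    refine ⟨fun I => hk ?_⟩
    obtain ⟨i, -, hi⟩ := key I.2
    exact ⟨i, hi⟩

lemma idealCount_split (hp : p.Prime) {P Q : Ideal R} [P.IsPrime] [Q.IsPrime]
    (hP : Ideal.absNorm P = p) (hQ : Ideal.absNorm Q = p) (hPQ : P ≠ Q)
    (h : Ideal.span {(p : R)} = P * Q) (k : ℕ) : idealCount R (p ^ k) = k + 1 := by
  have hbot : ∀ {P : Ideal R}, Ideal.absNorm P = p → P ≠ ⊥ := by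
    rintro P hP rfl
    exact hp.ne_zero (by rw [← hP, Ideal.absNorm_bot])
  have hPp : Prime P := Ideal.prime_of_isPrime (hbot hP) ‹_›
  have hQp : Prime Q := Ideal.prime_of_isPrime (hbot hQ) ‹_›
  have hndvd : ¬ P ∣ Q := by
    intro hd
    exact hPQ (associated_iff_eq.1 (hPp.associated_of_dvd hQp hd))
  let f : Fin (k + 1) → {I : Ideal R // Ideal.absNorm I = p ^ k} := fun i =>
    ⟨P ^ (i : ℕ) * Q ^ (k - i), by
      rw [map_mul, map_pow, map_pow, hP, hQ, ← pow_add,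
        Nat.add_sub_cancel' (Nat.lt_succ_iff.1 i.2)]⟩
  have hf : Function.Bijective f := by
    constructor
    · -- the multiplicity of `P` recovers the exponent
      have hlt : ∀ i j : Fin (k + 1), f i = f j → ¬ (i : ℕ) < j := by
        intro i j hij hlt
        have hij : P ^ (i : ℕ) * Q ^ (k - i) = P ^ (j : ℕ) * Q ^ (k - j) :=
          congrArg Subtype.val hij
        obtain ⟨c, hc⟩ := Nat.exists_eq_add_of_lt hlt
        rw [hc, add_assoc, pow_add, mul_assoc] at hij
        have := mul_left_cancel₀ (pow_ne_zero _ hPp.ne_zero) hij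
        refine hndvd (hPp.dvd_of_dvd_pow (n := k - i) ?_)
        rw [this]
        exact (dvd_pow_self P (Nat.succ_ne_zero c)).mul_right _
      intro i j hij
      exact Fin.ext (le_antisymm (not_lt.1 (hlt j i hij.symm)) (not_lt.1 (hlt i j hij)))
    · rintro ⟨I, hI⟩
      have hdvd := dvd_span_pow_of_absNorm hI
      rw [h, mul_pow] at hdvd
      obtain ⟨A, B, hA, hB, rfl⟩ := exists_dvd_and_dvd_of_dvd_mul hdvd
      obtain ⟨i, -, hi⟩ := (dvd_prime_pow hPp _).1 hA
      obtain ⟨j, -, hj⟩ := (dvd_prime_pow hQp _).1 hB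
      rw [associated_iff_eq] at hi hj
      subst hi hj
      have hij : i + j = k := by
        rw [map_mul, map_pow, map_pow, hP, hQ, ← pow_add] at hI
        exact Nat.pow_right_injective hp.two_le hI
      refine ⟨⟨i, by omega⟩, Subtype.ext ?_⟩
      simp only [f, ← hij, Nat.add_sub_cancel_left]
  rw [idealCount_apply (pow_ne_zero k hp.ne_zero), ← Nat.card_congr (Equiv.ofBijective f hf),
    Nat.card_eq_fintype_card, Fintype.card_fin]
  push_cast
  rfl

end IdealCount

section Quadratic

variable {R : Type*} [CommRing R] [IsDedekindDomain R] [Module.Free ℤ R]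

/-- When `R = ℤ ⊕ ℤ ζ`, the subgroups invariant under multiplication by `ζ` are the ideals. -/
lemma invCount_rootEnd_eq {c : ℤ} {ζ : R} (hζ : ζ ^ 2 + c * ζ + 1 = 0)
    (hb : Function.Bijective fun v : ℤ × ℤ => (v.1 : R) + v.2 * ζ) (n : ℕ) :
    invCount (rootEnd c) n = Nat.card {I : Ideal R // Ideal.absNorm I = n} := by
  let e : ℤ × ℤ ≃+ R := AddEquiv.ofBijective
    ({ toFun := fun v => (v.1 : R) + v.2 * ζ
       map_zero' := by simp
       map_add' := fun v w => by simp only [Prod.fst_add, Prod.snd_add]; push_cast; ring } :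
      ℤ × ℤ →+ R) hb
  have he : ∀ v, e v = (v.1 : R) + v.2 * ζ := fun _ => rfl
  rw [invCount_congr (α' := AddMonoidHom.mulLeft ζ) e fun v => by
    rw [AddMonoidHom.coe_mulLeft, he, he, rootEnd_apply]
    push_cast
    linear_combination (-(v.2 : R)) * hζ]
  refine Nat.card_congr
    { toFun := fun H => ⟨{ H.1 with
        smul_mem' := fun r x hx => ?_ }, H.2.1⟩
      invFun := fun I => ⟨I.1.toAddSubgroup, I.2, fun a ha => I.1.mul_mem_left ζ ha⟩
      left_inv := fun _ => rfl
      right_inv := fun _ => rfl }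
  obtain ⟨v, rfl⟩ := e.surjective r
  have h1 : x ∈ H.1 := hx
  have h2 : ζ * x ∈ H.1 := H.2.2 x h1
  have h3 := H.1.add_mem (H.1.zsmul_mem h1 v.1) (H.1.zsmul_mem h2 v.2)
  change e v * x ∈ H.1
  convert h3 using 1
  rw [he, zsmul_eq_mul, zsmul_eq_mul]
  ring

end Quadratic

/-- The divisor sum of a character modulo `q` at a prime power. -/
lemma oneSeq_mul_apply_prime_pow {q : ℕ} {χ : MulChar (ZMod q) ℤ} {g : ArithmeticFunction ℤ}
    (hg : ∀ n : ℕ, g n = χ n) {p : ℕ} (hp : p.Prime) (k : ℕ) :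
    (oneSeq * g) (p ^ k) = ∑ j ∈ Finset.range (k + 1), χ p ^ j := by
  have h : ∀ x ∈ (p ^ k).divisorsAntidiagonal, oneSeq x.1 * g x.2 = g x.2 := fun x hx => by
    rw [oneSeq_apply (Nat.ne_zero_of_mem_divisorsAntidiagonal hx).1, one_mul]
  rw [ArithmeticFunction.mul_apply, Finset.sum_congr rfl h,
    Nat.sum_divisorsAntidiagonal' (fun _ j => g j), Nat.sum_divisors_prime_pow hp]
  exact Finset.sum_congr rfl fun j _ => by rw [hg, Nat.cast_pow, map_pow]

lemma isMultiplicative_of_mulChar {q : ℕ} {χ : MulChar (ZMod q) ℤ} {g : ArithmeticFunction ℤ}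
    (hg : ∀ n : ℕ, g n = χ n) : g.IsMultiplicative := by
  constructor
  · rw [hg, Nat.cast_one, map_one]
  · intro m n _
    rw [hg, hg, hg, Nat.cast_mul, map_mul]

lemma oneSeq_isMultiplicative : oneSeq.IsMultiplicative := by
  rw [ArithmeticFunction.IsMultiplicative.iff_ne_zero]
  refine ⟨oneSeq_apply one_ne_zero, fun hm hn _ => ?_⟩
  rw [oneSeq_apply hm, oneSeq_apply hn, oneSeq_apply (mul_ne_zero hm hn), one_mul]

open NumberField in
/-- In a quadratic cyclotomic field of prime power conductor, the ideals of norm `n` are counted by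
the divisor sum of the non-principal character. Both sides are multiplicative, and at the powers of
a prime `p` they agree because `p` ramifies, splits or is inert according as the character takes the
value `0`, `1` or `-1` at `p`. -/
lemma idealCount_cyclotomic (l a : ℕ) [hl : Fact l.Prime] (K : Type*) [Field K] [NumberField K]
    [IsCyclotomicExtension {l ^ (a + 1)} ℚ K] (hφ : Nat.totient (l ^ (a + 1)) = 2)
    {χ : MulChar (ZMod (l ^ (a + 1))) ℤ}
    (hχ : ∀ x : ZMod (l ^ (a + 1)), IsUnit x → (x = 1 ∧ χ x = 1) ∨ (orderOf x = 2 ∧ χ x = -1))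
    {g : ArithmeticFunction ℤ} (hg : ∀ n : ℕ, g n = χ n) :
    idealCount (𝓞 K) = oneSeq * g := by
  have hfin : Module.finrank ℚ K = 2 := by
    rw [IsCyclotomicExtension.Rat.finrank (l ^ (a + 1)) K, hφ]
  have hfinZ : Module.finrank ℤ (𝓞 K) = 2 := by rw [RingOfIntegers.rank, hfin]
  rw [ArithmeticFunction.IsMultiplicative.eq_iff_eq_on_prime_powers _ idealCount_isMultiplicative _
    (oneSeq_isMultiplicative.mul (isMultiplicative_of_mulChar hg))]
  intro p k hp
  have : Fact p.Prime := ⟨hp⟩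
  rw [oneSeq_mul_apply_prime_pow hg hp]
  have hNp : Ideal.absNorm (Ideal.span {(p : 𝓞 K)}) = p ^ 2 := by
    rw [Ideal.absNorm_span_natCast, hfinZ]
  by_cases hpl : p ∣ l ^ (a + 1)
  · obtain rfl : p = l := (Nat.prime_dvd_prime_iff_eq hp hl.out).1 (hp.dvd_of_dvd_pow hpl)
    have hζ := IsCyclotomicExtension.zeta_spec (p ^ (a + 1)) ℚ K
    have h1 := IsCyclotomicExtension.Rat.absNorm_span_zeta_sub_one p a hζ
    have h2 := IsCyclotomicExtension.Rat.map_eq_span_zeta_sub_one_pow p a hζ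
    have h3 := IsCyclotomicExtension.Rat.isPrime_span_zeta_sub_one p a hζ
    rw [hfin, Ideal.map_span, Set.image_singleton, map_natCast] at h2
    rw [idealCount_ramified hp h1 h2]
    have hχp : χ p = 0 := by
      apply MulChar.map_nonunit
      rw [ZMod.isUnit_iff_coprime, hp.coprime_iff_not_dvd, not_not]
      exact hpl
    rw [hχp, Finset.sum_eq_single 0 (fun j _ hj => zero_pow hj) (by simp), pow_zero]
  · obtain ⟨⟨P, hPprime, hPover⟩⟩ :=
      Ideal.nonempty_primesOver (S := 𝓞 K) (Ideal.span {(p : ℤ)})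
    have hf := IsCyclotomicExtension.Rat.inertiaDeg_eq_of_not_dvd p K P hpl
    have he := IsCyclotomicExtension.Rat.ramificationIdx_eq_of_not_dvd p K P hpl
    have hN := Ideal.pow_inertiaDeg p P
    have hmap : Ideal.map (algebraMap ℤ (𝓞 K)) (Ideal.span {(p : ℤ)}) = Ideal.span {(p : 𝓞 K)} := by
      rw [Ideal.map_span, Set.image_singleton, map_natCast]
    have hp0 : Ideal.span {(p : 𝓞 K)} ≠ ⊥ := by
      intro h
      rw [h, Ideal.absNorm_bot] at hNp
      exact pow_ne_zero 2 hp.ne_zero hNp.symm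
    have hdvd : P ∣ Ideal.span {(p : 𝓞 K)} := by
      rw [Ideal.dvd_iff_le, ← hmap, Ideal.map_le_iff_le_comap]
      exact ((Ideal.liesOver_iff _ _).1 hPover).le
    rw [hf] at hN
    have hunit : IsUnit (p : ZMod (l ^ (a + 1))) := by
      rw [ZMod.isUnit_iff_coprime]
      exact hp.coprime_iff_not_dvd.2 hpl
    obtain ⟨Q, hQ⟩ := hdvd
    have hNQ : Ideal.absNorm P * Ideal.absNorm Q = p ^ 2 := by rw [← map_mul, ← hQ, hNp]
    rcases hχ _ hunit with ⟨h1, h2⟩ | ⟨h1, h2⟩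
    · rw [h1, orderOf_one, pow_one] at hN
      rw [← hN, sq] at hNQ
      have hNQ' := Nat.eq_of_mul_eq_mul_left hp.pos hNQ
      have hQprime : Q.IsPrime := Ideal.isPrime_of_irreducible_absNorm (by rw [hNQ']; exact hp)
      have hne : P ≠ Q := by
        rintro rfl
        rw [Ideal.IsDedekindDomain.ramificationIdx_eq_multiplicity (Ideal.span {(p : ℤ)}) _
          (by rwa [hmap]), hmap, hQ, ← sq, multiplicity_pow_self] at he
        · omega
        · rintro rfl
          exact hp.ne_zero (by rw [hN]; exact Ideal.absNorm_bot)
        · rw [Ideal.isUnit_iff]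
          exact hPprime.ne_top
      rw [idealCount_split hp hN.symm hNQ' hne hQ, h2]
      simp
    · rw [h1] at hN
      rw [← hN] at hNQ
      have hQ1 : Q = ⊤ := by
        rw [← Ideal.absNorm_eq_one_iff]
        exact Nat.eq_of_mul_eq_mul_left (pow_pos hp.pos 2) (by rw [hNQ, mul_one])
      have hPp : Ideal.span {(p : 𝓞 K)} = P := by rw [hQ, hQ1, Ideal.mul_top]
      have : (Ideal.span {(p : 𝓞 K)}).IsPrime := hPp ▸ hPprime
      rw [idealCount_inert hp hNp, h2, neg_one_geom_sum]
      simp only [Nat.even_add_one, ite_not]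

open NumberField in
/-- The ring of integers of a quadratic cyclotomic field is `ℤ ⊕ ℤ ζ`. -/
lemma bijective_integer_add_mul_zeta {q : ℕ} [NeZero q] {K : Type*} [Field K] [NumberField K]
    [IsCyclotomicExtension {q} ℚ K] (hφ : Nat.totient q = 2) {ζ : K} (hζ : IsPrimitiveRoot ζ q) :
    Function.Bijective fun v : ℤ × ℤ => (v.1 : 𝓞 K) + v.2 * hζ.toInteger := by
  let pb := hζ.integralPowerBasis
  have hdim : pb.dim = 2 := by rw [← hφ]; exact hζ.integralPowerBasis_dim
  have hgen : pb.gen = hζ.toInteger := hζ.integralPowerBasis_gen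
  let b : Module.Basis (Fin 2) ℤ (𝓞 K) := pb.basis.reindex (finCongr hdim)
  have hb : ∀ i, b i = hζ.toInteger ^ (i : ℕ) := by
    intro i
    simp [b, ← hgen]
  have : (fun v : ℤ × ℤ => (v.1 : 𝓞 K) + v.2 * hζ.toInteger) =
      b.equivFun.symm ∘ (finTwoArrowEquiv ℤ).symm := by
    funext v
    simp [Module.Basis.equivFun_symm_apply, Fin.sum_univ_two, hb, finTwoArrowEquiv]
  rw [this]
  exact b.equivFun.symm.bijective.comp (finTwoArrowEquiv ℤ).symm.bijective

open NumberField in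
lemma invCount_rootEnd_cyclotomic (l a : ℕ) [Fact l.Prime] (K : Type*) [Field K] [NumberField K]
    [IsCyclotomicExtension {l ^ (a + 1)} ℚ K] (hφ : Nat.totient (l ^ (a + 1)) = 2)
    {χ : MulChar (ZMod (l ^ (a + 1))) ℤ}
    (hχ : ∀ x : ZMod (l ^ (a + 1)), IsUnit x → (x = 1 ∧ χ x = 1) ∨ (orderOf x = 2 ∧ χ x = -1))
    {g : ArithmeticFunction ℤ} (hg : ∀ n : ℕ, g n = χ n) {c : ℤ}
    (hc : ∀ ζ : 𝓞 K, IsPrimitiveRoot ζ (l ^ (a + 1)) → ζ ^ 2 + c * ζ + 1 = 0) {n : ℕ}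
    (hn : n ≠ 0) : (oneSeq * g) n = invCount (rootEnd c) n := by
  have hζ := IsCyclotomicExtension.zeta_spec (l ^ (a + 1)) ℚ K
  rw [← idealCount_cyclotomic l a K hφ hχ hg, idealCount_apply hn,
    invCount_rootEnd_eq (hc _ hζ.toInteger_isPrimitiveRoot)
      (bijective_integer_add_mul_zeta hφ hζ)]

/-- The ideals of norm `n` of the Eisenstein integers are counted by the divisor sum of the
non-principal character modulo three. -/
lemma invCount_rootEnd_one {n : ℕ} (hn : n ≠ 0) :
    (oneSeq * chiThreeSeq) n = invCount (rootEnd 1) n := by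
  have h : ∀ x : ZMod 3, IsUnit x →
      (x = 1 ∧ chiThree x = 1) ∨ ((x ^ 2 = 1 ∧ x ≠ 1) ∧ chiThree x = -1) := by decide
  have : Fact (Nat.Prime 3) := ⟨Nat.prime_three⟩
  have : IsCyclotomicExtension {3 ^ (0 + 1)} ℚ (CyclotomicField (3 ^ (0 + 1)) ℚ) :=
    CyclotomicField.isCyclotomicExtension _ _
  refine invCount_rootEnd_cyclotomic 3 0 (CyclotomicField (3 ^ (0 + 1)) ℚ) (by decide)
    (χ := chiThree) ?_ (fun _ => rfl) ?_ hn
  · have : Fact (Nat.Prime 2) := ⟨Nat.prime_two⟩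
    exact fun x hx => (h x hx).imp_right fun h' => ⟨orderOf_eq_prime h'.1.1 h'.1.2, h'.2⟩
  · intro ζ hζ
    have h1 : ζ ^ 3 = 1 := hζ.pow_eq_one
    have h2 : ζ ≠ 1 := hζ.ne_one (by norm_num)
    refine mul_left_cancel₀ (sub_ne_zero.2 h2) ?_
    push_cast
    linear_combination h1

/-- The ideals of norm `n` of the Gaussian integers are counted by the divisor sum of the
non-principal character modulo four. -/
lemma invCount_rootEnd_zero {n : ℕ} (hn : n ≠ 0) :
    (oneSeq * chiFourSeq) n = invCount (rootEnd 0) n := by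
  have : Fact (Nat.Prime 2) := ⟨Nat.prime_two⟩
  have : IsCyclotomicExtension {2 ^ (1 + 1)} ℚ (CyclotomicField (2 ^ (1 + 1)) ℚ) :=
    CyclotomicField.isCyclotomicExtension _ _
  refine invCount_rootEnd_cyclotomic 2 1 (CyclotomicField (2 ^ (1 + 1)) ℚ) (by decide)
    (χ := chiFour) ?_ (fun _ => rfl) ?_ hn
  · have h : ∀ x : ZMod 4, IsUnit x →
        (x = 1 ∧ chiFour x = 1) ∨ ((x ^ 2 = 1 ∧ x ≠ 1) ∧ chiFour x = -1) := by decide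
    exact fun x hx => (h x hx).imp_right fun h' => ⟨orderOf_eq_prime h'.1.1 h'.1.2, h'.2⟩
  · intro ζ hζ
    have h1 : ζ ^ 4 = 1 := hζ.pow_eq_one
    have h2 : ζ ^ 2 ≠ 1 := hζ.pow_ne_one_of_pos_of_lt (by norm_num) (by norm_num)
    refine mul_left_cancel₀ (sub_ne_zero.2 h2) ?_
    push_cast
    linear_combination h1

/-! ### Invariant sublattices of the tetrahedral lattice -/

lemma AddSubgroup.eq_of_le_of_index_eq' {A : Type*} [AddCommGroup A] {H K : AddSubgroup A}
    (h : H ≤ K) (hi : H.index = K.index) (h0 : K.index ≠ 0) : H = K := by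
  refine le_antisymm h (AddSubgroup.relIndex_eq_one.1 ?_)
  have := AddSubgroup.relIndex_mul_index h
  rw [hi] at this
  exact Nat.eq_of_mul_eq_mul_right (Nat.pos_of_ne_zero h0) (this.trans (one_mul _).symm)

/-- A sublattice of finite index is fixed by `σ` as soon as `σ` maps it into itself. -/
lemma tetraFixed_eq_invCount (σ : Equiv.Perm (Fin 4)) {n : ℕ} (hn : n ≠ 0) :
    tetraFixed σ n = invCount (permLattice σ).toAddMonoidHom n := by
  refine Nat.card_congr
    { toFun := fun L => ⟨L.1.1, L.1.2, fun a ha => ?_⟩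
      invFun := fun H => ⟨⟨H.1, H.2.1⟩, Subtype.ext ?_⟩
      left_inv := fun _ => rfl
      right_inv := fun _ => rfl }
  · have h : L.1.1.map (permLattice σ).toAddMonoidHom = L.1.1 := congrArg Subtype.val L.2
    rw [← h]
    exact ⟨a, ha, rfl⟩
  · refine AddSubgroup.eq_of_le_of_index_eq' ?_ ?_ (by rw [H.2.1]; exact hn)
    · rintro _ ⟨a, ha, rfl⟩
      exact H.2.2 a ha
    · exact AddSubgroup.index_map_of_bijective (permLattice σ).bijective H.1

/-- The number of fixed points of a group element depends only on its conjugacy class. -/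
lemma card_fixedBy_eq_of_isConj {G X : Type*} [Group G] [MulAction G X] {g h : G}
    (hgh : IsConj g h) :
    Nat.card (MulAction.fixedBy X g) = Nat.card (MulAction.fixedBy X h) := by
  obtain ⟨c, rfl⟩ := isConj_iff.1 hgh
  refine Nat.card_congr ((MulAction.toPerm c).subtypeEquiv fun x => ?_)
  simp only [MulAction.mem_fixedBy, MulAction.toPerm_apply, mul_smul, inv_smul_smul,
    smul_left_cancel_iff]

lemma tetraFixed_congr {σ τ : Equiv.Perm (Fin 4)} (h : σ.cycleType = τ.cycleType) (n : ℕ) :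
    tetraFixed σ n = tetraFixed τ n :=
  card_fixedBy_eq_of_isConj (Equiv.Perm.isConj_iff_cycleType_eq.2 h)

/-- Coordinates `f` on the lattice, with inverse `g`. -/
def tetraEquiv {A : Type*} [AddCommGroup A] (f : (Fin 4 → ℤ) →+ A) (g : A → Fin 4 → ℤ)
    (hg : ∀ p, ∑ i, g p i = 0) (hfg : ∀ p, f (g p) = p)
    (hgf : ∀ v : Fin 4 → ℤ, ∑ i, v i = 0 → g (f v) = v) : tetraLattice ≃+ A where
  toFun v := f v.1
  invFun p := ⟨g p, hg p⟩
  left_inv v := Subtype.ext (hgf v.1 v.2)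
  right_inv := hfg
  map_add' v w := map_add f v.1 w.1

/-- The invariant sublattices are counted in coordinates `f`, with inverse `g`, in which `σ` acts as
the endomorphism `α`. -/
lemma tetraFixed_eq_of_coordinates {σ : Equiv.Perm (Fin 4)} {A : Type*} [AddCommGroup A]
    {α : A →+ A} (f : (Fin 4 → ℤ) →+ A) (g : A → Fin 4 → ℤ) (hg : ∀ p, ∑ i, g p i = 0)
    (hfg : ∀ p, f (g p) = p) (hgf : ∀ v : Fin 4 → ℤ, ∑ i, v i = 0 → g (f v) = v)
    (hα : ∀ v : Fin 4 → ℤ, ∑ i, v i = 0 → f (fun i => v (σ.symm i)) = α (f v)) {n : ℕ}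
    (hn : n ≠ 0) : tetraFixed σ n = invCount α n := by
  rw [tetraFixed_eq_invCount σ hn]
  exact invCount_congr (tetraEquiv f g hg hfg hgf) (fun v => hα v.1 v.2) n

/-- The homomorphism from `ℤ⁴` to `ℤ² × ℤ` with given coefficient vectors. -/
def coordHom (a b c : Fin 4 → ℤ) : (Fin 4 → ℤ) →+ (ℤ × ℤ) × ℤ where
  toFun v := ((a ⬝ᵥ v, b ⬝ᵥ v), c ⬝ᵥ v)
  map_zero' := by simp
  map_add' v w := by simp [dotProduct_add]

lemma coordHom_apply (a b c v : Fin 4 → ℤ) :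
    coordHom a b c v =
      ((a 0 * v 0 + a 1 * v 1 + a 2 * v 2 + a 3 * v 3,
        b 0 * v 0 + b 1 * v 1 + b 2 * v 2 + b 3 * v 3),
        c 0 * v 0 + c 1 * v 1 + c 2 * v 2 + c 3 * v 3) := by
  simp [coordHom, dotProduct, Fin.sum_univ_four]

section Representatives

open Equiv

/-- A permutation of cycle type `x₁² x₂`. -/
def permTwo : Perm (Fin 4) := swap 0 1

/-- A permutation of cycle type `x₂²`. -/
def permTwoTwo : Perm (Fin 4) := swap 0 1 * swap 2 3

/-- The permutation `0 ↦ 1 ↦ 2 ↦ 0` of cycle type `x₁ x₃`. -/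
def permThree : Perm (Fin 4) := swap 0 1 * swap 1 2

/-- The permutation `0 ↦ 1 ↦ 2 ↦ 3 ↦ 0` of cycle type `x₄`. -/
def permFour : Perm (Fin 4) := swap 0 1 * swap 1 2 * swap 2 3

lemma cycleType_permTwo : permTwo.cycleType = {2} := by decide
lemma cycleType_permTwoTwo : permTwoTwo.cycleType = {2, 2} := by decide
lemma cycleType_permThree : permThree.cycleType = {3} := by decide
lemma cycleType_permFour : permFour.cycleType = {4} := by decide

lemma permTwo_symm : (permTwo.symm : Fin 4 → Fin 4) = ![1, 0, 2, 3] := by decide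
lemma permTwoTwo_symm : (permTwoTwo.symm : Fin 4 → Fin 4) = ![1, 0, 3, 2] := by decide
lemma permThree_symm : (permThree.symm : Fin 4 → Fin 4) = ![2, 0, 1, 3] := by decide
lemma permFour_symm : (permFour.symm : Fin 4 → Fin 4) = ![3, 0, 1, 2] := by decide

variable {n : ℕ}

/-- The first three coordinates identify the lattice with `ℤ³`. -/
def tetraEquivInt : tetraLattice ≃+ (ℤ × ℤ) × ℤ :=
  tetraEquiv (coordHom ![1, 0, 0, 0] ![0, 1, 0, 0] ![0, 0, 1, 0])
    (fun p => ![p.1.1, p.1.2, p.2, -(p.1.1 + p.1.2 + p.2)])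
    (fun p => by simp [Fin.sum_univ_four]) (fun p => by simp [coordHom_apply])
    (fun v hv => by
      rw [Fin.sum_univ_four] at hv
      funext i
      fin_cases i <;> simp [coordHom_apply]
      omega)

lemma tetraFixed_one (hn : n ≠ 0) : (tetraFixed 1 n : ℤ) = (oneSeq * natSeq * sqSeq) n := by
  rw [tetraFixed_eq_invCount 1 hn,
    invCount_congr (α' := AddMonoidHom.id _) tetraEquivInt (fun _ => rfl),
    invCount_id_int_prod_prod hn]

/-- In the basis `e₀ - e₁, e₀ - e₂, e₂ - e₃`. -/
lemma tetraFixed_permTwo (hn : n ≠ 0) :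
    (tetraFixed permTwo n : ℤ) = (finiteSeq [1, -1, 0, 4] * oneSeq * oneSeq * natSeq) n := by
  rw [tetraFixed_eq_of_coordinates (α := extEnd (swapEnd (-1) 1) 0 1)
    (coordHom ![0, -1, 0, 0] ![1, 1, 0, 0] ![0, 0, 0, -1])
    (fun p => ![p.1.1 + p.1.2, -p.1.1, -p.1.2 + p.2, -p.2]) ?_ ?_ ?_ ?_ hn,
    invCount_swap isUnit_one.neg isUnit_one hn]
  · intro p
    simp [Fin.sum_univ_four]
  · intro p
    simp [coordHom_apply]
  · intro v hv
    rw [Fin.sum_univ_four] at hv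
    funext i
    fin_cases i <;> simp [coordHom_apply]
    omega
  · intro v hv
    rw [Fin.sum_univ_four] at hv
    simp [coordHom_apply, permTwo_symm, swapEnd]
    omega

/-- In the basis `e₀ + e₁ - e₂ - e₃, e₀ - e₂, e₀ - e₁`. -/
lemma tetraFixed_permTwoTwo (hn : n ≠ 0) :
    (tetraFixed permTwoTwo n : ℤ) = (finiteSeq [1, -1, 0, 4] * oneSeq * oneSeq * natSeq) n := by
  rw [tetraFixed_eq_of_coordinates (α := extEnd (swapEnd 1 (-1)) 0 (-1))
    (coordHom ![0, 0, 0, -1] ![0, 0, -1, 1] ![0, -1, 0, -1])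
    (fun p => ![p.1.1 + p.1.2 + p.2, p.1.1 - p.2, -p.1.1 - p.1.2, -p.1.1]) ?_ ?_ ?_ ?_ hn,
    invCount_swap isUnit_one isUnit_one.neg hn]
  · intro p
    simp [Fin.sum_univ_four]
    ring
  · intro p
    simp [coordHom_apply]
  · intro v hv
    rw [Fin.sum_univ_four] at hv
    funext i
    fin_cases i <;> simp [coordHom_apply]
    omega
  · intro v hv
    rw [Fin.sum_univ_four] at hv
    simp [coordHom_apply, permTwoTwo_symm, swapEnd]
    omega

/-- In the basis `e₁ - e₀, e₂ - e₁, e₀ - e₃`, whose first two vectors span a copy of the Eisenstein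
integers. -/
lemma tetraFixed_permThree (hn : n ≠ 0) :
    (tetraFixed permThree n : ℤ) =
      (finiteSeq [1, 0, -1, 0, 0, 0, 0, 0, 3] * oneSeq * oneSeq * chiThreeSeq) n := by
  rw [tetraFixed_eq_of_coordinates (α := extEnd (rootEnd 1) (1, 0) 1)
    (coordHom ![0, 1, 1, 0] ![0, 0, 1, 0] ![0, 0, 0, -1])
    (fun p => ![p.2 - p.1.1, p.1.1 - p.1.2, p.1.2, -p.2]) ?_ ?_ ?_ ?_ hn,
    invCount_extEnd_rootEnd_three (fun m hm => invCount_rootEnd_one hm) hn, ← mul_assoc]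
  · intro p
    simp [Fin.sum_univ_four]
  · intro p
    simp [coordHom_apply]
  · intro v hv
    rw [Fin.sum_univ_four] at hv
    funext i
    fin_cases i <;> simp [coordHom_apply]
    omega
  · intro v hv
    rw [Fin.sum_univ_four] at hv
    simp [coordHom_apply, permThree_symm]
    omega

/-- In the basis `e₂ - e₀, e₃ - e₁, e₁ - e₀`, whose first two vectors span a copy of the Gaussian
integers. -/
lemma tetraFixed_permFour (hn : n ≠ 0) :
    (tetraFixed permFour n : ℤ) =
      (finiteSeq [1, -1, 0, 2] * oneSeq * oneSeq * chiFourSeq) n := by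
  rw [tetraFixed_eq_of_coordinates (α := extEnd (rootEnd 0) (1, 0) (-1))
    (coordHom ![0, 0, 1, 0] ![0, 0, 0, 1] ![0, 1, 0, 1])
    (fun p => ![-p.1.1 - p.2, -p.1.2 + p.2, p.1.1, p.1.2]) ?_ ?_ ?_ ?_ hn,
    invCount_extEnd_rootEnd_four (fun m hm => invCount_rootEnd_zero hm) hn, ← mul_assoc]
  · intro p
    simp [Fin.sum_univ_four]
  · intro p
    simp [coordHom_apply]
  · intro v hv
    rw [Fin.sum_univ_four] at hv
    funext i
    fin_cases i <;> simp [coordHom_apply]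
    omega
  · intro v hv
    rw [Fin.sum_univ_four] at hv
    simp [coordHom_apply, permFour_symm]
    omega

end Representatives

lemma finite_tetraSublattice {n : ℕ} (hn : n ≠ 0) : Finite (TetraSublattice n) := by
  let f : TetraSublattice n → InvSub (AddMonoidHom.id tetraLattice) n :=
    fun L => ⟨L.1, L.2, fun _ ha => ha⟩
  have := finite_invSub_id_int_prod_prod n hn
  have : Finite (InvSub (AddMonoidHom.id tetraLattice) n) :=
    Finite.of_equiv _ (invSubCongr (α := AddMonoidHom.id _) tetraEquivInt.symm (fun _ => rfl) n)
  exact Finite.of_injective f fun L L' h =>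
    Subtype.ext (congrArg (fun K : InvSub (AddMonoidHom.id tetraLattice) n => K.1) h)

/-! ### Duality between orbifold groups and sublattices -/

/-- The character `t ↦ ∏ tᵢ ^ mᵢ` of the torus, as a homomorphism in the exponent vector `m`. -/
def torusPairing (t : Fin 4 → ℂˣ) : Multiplicative (Fin 4 → ℤ) →* ℂˣ where
  toFun m := ∏ i, t i ^ (m.toAdd i)
  map_one' := by simp
  map_mul' m m' := by simp [zpow_add, Finset.prod_mul_distrib]

lemma torusPairing_apply (t : Fin 4 → ℂˣ) (m : Fin 4 → ℤ) :
    torusPairing t (Multiplicative.ofAdd m) = ∏ i, t i ^ m i := rfl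

lemma torusPairing_mul (t u : Fin 4 → ℂˣ) :
    torusPairing (t * u) = torusPairing t * torusPairing u := by
  refine MonoidHom.ext fun m => ?_
  obtain ⟨m, rfl⟩ := Multiplicative.ofAdd.surjective m
  simp [torusPairing_apply, mul_zpow, Finset.prod_mul_distrib]

/-- Every character of `ℤ⁴` is evaluation at a point of the torus. -/
lemma exists_torusPairing_eq (φ : Multiplicative (Fin 4 → ℤ) →* ℂˣ) :
    ∃ t, torusPairing t = φ := by
  refine ⟨fun i => φ (Multiplicative.ofAdd (Pi.single i 1)), ?_⟩
  refine MonoidHom.ext fun m => ?_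
  obtain ⟨m, rfl⟩ := Multiplicative.ofAdd.surjective m
  rw [torusPairing_apply]
  simp only [← map_zpow, ← map_prod, ← ofAdd_zsmul, ← ofAdd_sum]
  congr 2
  funext j
  simp [Pi.single_apply]

lemma torusPairing_injective : Function.Injective torusPairing := by
  intro t u h
  funext i
  have := DFunLike.congr_fun h (Multiplicative.ofAdd (Pi.single i 1))
  simpa [torusPairing_apply, Pi.single_apply, Finset.prod_ite_eq', apply_ite] using this

/-- The exponent vectors of the characters that are trivial on `Γ`. -/
def torusAnn (Γ : Subgroup (Fin 4 → ℂˣ)) : AddSubgroup (Fin 4 → ℤ) where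
  carrier := {m | ∀ t ∈ Γ, torusPairing t (Multiplicative.ofAdd m) = 1}
  zero_mem' := fun t _ => by rw [ofAdd_zero, map_one]
  add_mem' := fun ha hb t ht => by rw [ofAdd_add, map_mul, ha t ht, hb t ht, one_mul]
  neg_mem' := fun ha t ht => by rw [ofAdd_neg, map_inv, ha t ht, inv_one]

/-- The points of the torus at which the characters with exponent vectors in `H` are trivial. -/
def torusDual (H : AddSubgroup (Fin 4 → ℤ)) : Subgroup (Fin 4 → ℂˣ) where
  carrier := {t | ∀ m ∈ H, torusPairing t (Multiplicative.ofAdd m) = 1}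
  one_mem' := fun m _ => by simp [torusPairing_apply]
  mul_mem' := fun ha hb m hm => by
    rw [torusPairing_mul, MonoidHom.mul_apply, ha m hm, hb m hm, one_mul]
  inv_mem' := fun ha m hm => by
    have := ha m hm
    rw [torusPairing_apply] at this ⊢
    simp [this]

/-- The points of `torusDual H` are the characters of `ℤ⁴ ⧸ H`. -/
noncomputable def torusDualEquiv (H : AddSubgroup (Fin 4 → ℤ)) :
    torusDual H ≃ (Multiplicative (Fin 4 → ℤ) ⧸ AddSubgroup.toSubgroup H →* ℂˣ) :=
  Equiv.ofBijective
    (fun t =>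
      QuotientGroup.lift (AddSubgroup.toSubgroup H) (torusPairing t.1) fun m hm => t.2 _ hm) <| by
    constructor
    · intro t u h
      apply Subtype.ext
      apply torusPairing_injective
      refine MonoidHom.ext fun m => ?_
      exact DFunLike.congr_fun h (m : Multiplicative (Fin 4 → ℤ) ⧸ AddSubgroup.toSubgroup H)
    · intro φ
      obtain ⟨t, ht⟩ := exists_torusPairing_eq (φ.comp (QuotientGroup.mk' _))
      refine ⟨⟨t, fun m hm => ?_⟩, ?_⟩
      · rw [ht, MonoidHom.comp_apply, QuotientGroup.mk'_apply, (QuotientGroup.eq_one_iff _).2,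
          map_one]
        exact hm
      · refine MonoidHom.ext fun x => ?_
        obtain ⟨m, rfl⟩ := QuotientGroup.mk_surjective x
        exact DFunLike.congr_fun ht m

lemma card_torusDual {H : AddSubgroup (Fin 4 → ℤ)} (hH : H.index ≠ 0) :
    Nat.card (torusDual H) = H.index := by
  rw [← AddSubgroup.index_toSubgroup] at hH ⊢
  have : Finite (Multiplicative (Fin 4 → ℤ) ⧸ AddSubgroup.toSubgroup H) :=
    Subgroup.index_ne_zero_iff_finite.1 hH
  rw [Nat.card_congr (torusDualEquiv H), CommGroup.card_monoidHom_of_hasEnoughRootsOfUnity,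
    Subgroup.index_eq_card]

lemma torusAnn_torusDual {H : AddSubgroup (Fin 4 → ℤ)} (hH : H.index ≠ 0) :
    torusAnn (torusDual H) = H := by
  rw [← AddSubgroup.index_toSubgroup] at hH
  have : Finite (Multiplicative (Fin 4 → ℤ) ⧸ AddSubgroup.toSubgroup H) :=
    Subgroup.index_ne_zero_iff_finite.1 hH
  apply le_antisymm
  · intro m hm
    by_contra hmH
    obtain ⟨φ, hφ⟩ := CommGroup.exists_apply_ne_one_of_hasEnoughRootsOfUnity
      (Multiplicative (Fin 4 → ℤ) ⧸ AddSubgroup.toSubgroup H) ℂ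
      (a := (Multiplicative.ofAdd m : Multiplicative (Fin 4 → ℤ))) fun h =>
        hmH ((QuotientGroup.eq_one_iff _).1 h)
    obtain ⟨t, rfl⟩ := (torusDualEquiv H).surjective φ
    exact hφ (hm t.1 t.2)
  · intro m hm t ht
    exact ht m hm

/-- The characters of `ℤ⁴` restricted to a finite group `Γ` are at most as many as all characters of
`Γ`. -/
lemma index_torusAnn {Γ : Subgroup (Fin 4 → ℂˣ)} (hΓ : Nat.card Γ ≠ 0) :
    (torusAnn Γ).index ≠ 0 ∧ (torusAnn Γ).index ≤ Nat.card Γ := by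
  have : Finite Γ := Nat.finite_of_card_ne_zero hΓ
  let ev : Multiplicative (Fin 4 → ℤ) →* (Γ →* ℂˣ) :=
    { toFun := fun m =>
        { toFun := fun t => torusPairing t.1 m
          map_one' := by
            obtain ⟨m, rfl⟩ := Multiplicative.ofAdd.surjective m
            simp [torusPairing_apply]
          map_mul' := fun t u => by
            rw [Subgroup.coe_mul, torusPairing_mul, MonoidHom.mul_apply] }
      map_one' := by
        ext t
        simp
      map_mul' := fun m m' => by
        ext t
        simp }
  have hker : AddSubgroup.toSubgroup (torusAnn Γ) = ev.ker := by
    ext m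
    rw [MonoidHom.mem_ker]
    constructor
    · intro h
      refine MonoidHom.ext fun t => ?_
      exact h t.1 t.2
    · intro h t ht
      exact DFunLike.congr_fun h ⟨t, ht⟩
  have hcard := CommGroup.card_monoidHom_of_hasEnoughRootsOfUnity Γ ℂ
  have : Finite (Γ →* ℂˣ) := Nat.finite_of_card_ne_zero (by rw [hcard]; exact hΓ)
  rw [← AddSubgroup.index_toSubgroup, hker, Subgroup.index_ker]
  exact ⟨Nat.card_pos.ne', hcard ▸ Subgroup.card_le_card_group _⟩

lemma torusDual_torusAnn {Γ : Subgroup (Fin 4 → ℂˣ)} (hΓ : Nat.card Γ ≠ 0) :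
    torusDual (torusAnn Γ) = Γ := by
  obtain ⟨h0, hle⟩ := index_torusAnn hΓ
  have hcard := card_torusDual h0
  have : Finite (torusDual (torusAnn Γ)) := Nat.finite_of_card_ne_zero (by rw [hcard]; exact h0)
  refine (Subgroup.eq_of_le_of_card_ge (fun t ht m hm => hm t ht) ?_).symm
  rw [hcard]
  exact hle

/-- Duality between finite subgroups `Γ` of the diagonal torus of determinant one and sublattices of
`ℤ⁴` of finite index containing `(1, 1, 1, 1)`. -/
def orbifoldEquiv {n : ℕ} (hn : n ≠ 0) :
    OrbifoldGroup n ≃ {H : AddSubgroup (Fin 4 → ℤ) // H.index = n ∧ 1 ∈ H} where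
  toFun Γ := ⟨torusAnn Γ.1, by
    have h : Nat.card Γ.1 ≠ 0 := by rw [Γ.2.2]; exact hn
    constructor
    · rw [← card_torusDual (index_torusAnn h).1, torusDual_torusAnn h, Γ.2.2]
    · intro t ht
      rw [torusPairing_apply]
      simpa using Γ.2.1 t ht⟩
  invFun H := ⟨torusDual H.1, by
    constructor
    · intro t ht
      have := ht 1 H.2.2
      rw [torusPairing_apply] at this
      simpa using this
    · rw [card_torusDual (by rw [H.2.1]; exact hn), H.2.1]⟩
  left_inv Γ := Subtype.ext (torusDual_torusAnn (by rw [Γ.2.2]; exact hn))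
  right_inv H := Subtype.ext (torusAnn_torusDual (by rw [H.2.1]; exact hn))

lemma torusPairing_permTorus (σ : Equiv.Perm (Fin 4)) (t : Fin 4 → ℂˣ) (m : Fin 4 → ℤ) :
    torusPairing (permTorus σ t) (Multiplicative.ofAdd fun i => m (σ.symm i)) =
      torusPairing t (Multiplicative.ofAdd m) :=
  Equiv.prod_comp σ.symm fun i => t i ^ m i

/-- Duality is compatible with the permutations of the coordinates. -/
lemma smul_eq_iff_torusAnn {n : ℕ} (hn : n ≠ 0) (σ : Equiv.Perm (Fin 4)) (Γ : OrbifoldGroup n) :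
    σ • Γ = Γ ↔ ∀ m ∈ torusAnn Γ.1, (fun i => m (σ.symm i)) ∈ torusAnn Γ.1 := by
  have hcard : Nat.card Γ.1 ≠ 0 := by rw [Γ.2.2]; exact hn
  have hfin : Finite Γ.1 := Nat.finite_of_card_ne_zero hcard
  constructor
  · intro h m hm t ht
    have h' : Γ.1.map (permTorus σ).toMonoidHom = Γ.1 := congrArg Subtype.val h
    rw [← h'] at ht
    obtain ⟨t, ht, rfl⟩ := ht
    exact (torusPairing_permTorus σ t m).trans (hm t ht)
  · intro h
    let π : (Fin 4 → ℤ) ≃+ (Fin 4 → ℤ) :=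
      { toFun := fun m i => m (σ.symm i)
        invFun := fun m i => m (σ i)
        left_inv := fun m => by funext i; simp
        right_inv := fun m => by funext i; simp
        map_add' := fun _ _ => rfl }
    have heq : (torusAnn Γ.1).map π.toAddMonoidHom = torusAnn Γ.1 := by
      refine AddSubgroup.eq_of_le_of_index_eq' ?_ ?_ (index_torusAnn hcard).1
      · rintro _ ⟨m, hm, rfl⟩
        exact h m hm
      · exact AddSubgroup.index_map_of_bijective π.bijective _
    apply Subtype.ext
    change Γ.1.map (permTorus σ).toMonoidHom = Γ.1
    refine Subgroup.eq_of_le_of_card_ge ?_ ?_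
    · rintro _ ⟨t, ht, rfl⟩
      rw [← torusDual_torusAnn hcard]
      intro m hm
      rw [← heq] at hm
      obtain ⟨m, hm, rfl⟩ := hm
      exact (torusPairing_permTorus σ t m).trans (hm t ht)
    · exact (Nat.card_congr (Γ.1.equivMapOfInjective (permTorus σ).toMonoidHom
        (permTorus σ).injective).toEquiv).le

/-- A surjection of `ℤ⁴` onto the tetrahedral lattice with kernel spanned by `(1, 1, 1, 1)` matches
the sublattices of `ℤ⁴` containing `(1, 1, 1, 1)` with those of the tetrahedral lattice. -/
def sublatticeEquiv (φ : (Fin 4 → ℤ) →+ tetraLattice) (hφ : Function.Surjective φ)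
    (hker : φ.ker = AddSubgroup.zmultiples 1) (n : ℕ) :
    {H : AddSubgroup (Fin 4 → ℤ) // H.index = n ∧ 1 ∈ H} ≃ TetraSublattice n where
  toFun H := ⟨H.1.map φ, by
    rw [AddSubgroup.index_map_eq _ hφ, H.2.1]
    rw [hker, AddSubgroup.zmultiples_le]
    exact H.2.2⟩
  invFun L := ⟨L.1.comap φ, by
    rw [AddSubgroup.index_comap_of_surjective _ hφ]
    refine ⟨L.2, ?_⟩
    have h1 : (1 : Fin 4 → ℤ) ∈ φ.ker := hker ▸ AddSubgroup.mem_zmultiples _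
    rw [AddSubgroup.mem_comap, (AddMonoidHom.mem_ker).1 h1]
    exact zero_mem _⟩
  left_inv H := Subtype.ext <| AddSubgroup.comap_map_eq_self <| by
    rw [hker, AddSubgroup.zmultiples_le]
    exact H.2.2
  right_inv L := Subtype.ext <| AddSubgroup.map_comap_eq_self_of_surjective hφ L.1

/-- When the surjection of `ℤ⁴` onto the tetrahedral lattice commutes with `σ`, the permutation `σ`
fixes as many orbifold groups as sublattices. -/
lemma card_fixedBy_orbifoldGroup {σ : Equiv.Perm (Fin 4)} (φ : (Fin 4 → ℤ) →+ tetraLattice)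
    (hφ : Function.Surjective φ) (hker : φ.ker = AddSubgroup.zmultiples 1)
    (hσ : ∀ v, φ (fun i => v (σ.symm i)) = permLattice σ (φ v)) {n : ℕ} (hn : n ≠ 0) :
    Nat.card (MulAction.fixedBy (OrbifoldGroup n) σ) = tetraFixed σ n := by
  rw [tetraFixed_eq_invCount σ hn]
  let e := (orbifoldEquiv hn).trans (sublatticeEquiv φ hφ hker n)
  have he : ∀ Γ : OrbifoldGroup n, σ • Γ = Γ ↔
      ∀ a ∈ (e Γ).1, (permLattice σ).toAddMonoidHom a ∈ (e Γ).1 := by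
    intro Γ
    have heΓ : (e Γ).1 = (torusAnn Γ.1).map φ := rfl
    have hle : φ.ker ≤ torusAnn Γ.1 := by
      rw [hker, AddSubgroup.zmultiples_le]
      exact (orbifoldEquiv hn Γ).2.2
    rw [smul_eq_iff_torusAnn hn, heΓ]
    constructor
    · rintro h _ ⟨m, hm, rfl⟩
      exact ⟨_, h m hm, hσ m⟩
    · intro h m hm
      have h1 : φ (fun i => m (σ.symm i)) ∈ (torusAnn Γ.1).map φ := by
        rw [hσ]
        exact h _ ⟨m, hm, rfl⟩
      rw [← AddSubgroup.mem_comap, AddSubgroup.comap_map_eq_self hle] at h1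
      exact h1
  let e₁ : MulAction.fixedBy (OrbifoldGroup n) σ ≃
      {L : TetraSublattice n // ∀ a ∈ L.1, (permLattice σ).toAddMonoidHom a ∈ L.1} :=
    e.subtypeEquiv he
  let e₂ : {L : TetraSublattice n // ∀ a ∈ L.1, (permLattice σ).toAddMonoidHom a ∈ L.1} ≃
      InvSub (permLattice σ).toAddMonoidHom n :=
    { toFun := fun L => ⟨L.1.1, L.1.2, L.2⟩
      invFun := fun H => ⟨⟨H.1, H.2.1⟩, H.2.2⟩
      left_inv := fun _ => rfl
      right_inv := fun _ => rfl }
  exact Nat.card_congr (e₁.trans e₂)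

/-- A surjection of `ℤ⁴` onto the tetrahedral lattice from a formula `φ`, with a section `ψ`. -/
lemma exists_surjection (φ : (Fin 4 → ℤ) →+ (Fin 4 → ℤ)) (ψ : (Fin 4 → ℤ) → Fin 4 → ℤ)
    (hφ : ∀ v, ∑ i, φ v i = 0) (hψ : ∀ w : Fin 4 → ℤ, ∑ i, w i = 0 → φ (ψ w) = w)
    (hker : ∀ v, φ v = 0 ↔ ∀ i, v i = v 0) :
    ∃ f : (Fin 4 → ℤ) →+ tetraLattice, Function.Surjective f ∧
      f.ker = AddSubgroup.zmultiples 1 ∧ ∀ v, (f v).1 = φ v := by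
  refine ⟨φ.codRestrict tetraLattice hφ, fun w => ⟨ψ w.1, Subtype.ext (hψ w.1 w.2)⟩, ?_,
    fun _ => rfl⟩
  ext v
  rw [AddMonoidHom.mem_ker, ← Subtype.coe_inj, AddSubgroup.mem_zmultiples_iff]
  refine (hker v).trans ⟨fun h => ⟨v 0, ?_⟩, ?_⟩
  · funext i
    simp [h i]
  · rintro ⟨c, rfl⟩ i
    simp

/-- The endomorphism of `ℤ⁴` with the given rows. -/
def rowHom (a b c d : Fin 4 → ℤ) : (Fin 4 → ℤ) →+ (Fin 4 → ℤ) where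
  toFun v := ![a ⬝ᵥ v, b ⬝ᵥ v, c ⬝ᵥ v, d ⬝ᵥ v]
  map_zero' := by simp
  map_add' v w := by simp [dotProduct_add]

lemma rowHom_apply (a b c d v : Fin 4 → ℤ) :
    rowHom a b c d v =
      ![a 0 * v 0 + a 1 * v 1 + a 2 * v 2 + a 3 * v 3,
        b 0 * v 0 + b 1 * v 1 + b 2 * v 2 + b 3 * v 3,
        c 0 * v 0 + c 1 * v 1 + c 2 * v 2 + c 3 * v 3,
        d 0 * v 0 + d 1 * v 1 + d 2 * v 2 + d 3 * v 3] := by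
  simp [rowHom, dotProduct, Fin.sum_univ_four]

/-- The self-duality of the lattice, as a lattice with an action of `σ`, from explicit formulas. -/
lemma card_fixedBy_orbifoldGroup_of_rows {σ : Equiv.Perm (Fin 4)} (a b c d : Fin 4 → ℤ)
    (ψ : (Fin 4 → ℤ) → Fin 4 → ℤ)
    (hφ : ∀ v, ∑ i, rowHom a b c d v i = 0)
    (hψ : ∀ w : Fin 4 → ℤ, ∑ i, w i = 0 → rowHom a b c d (ψ w) = w)
    (hker : ∀ v, rowHom a b c d v = 0 ↔ ∀ i, v i = v 0)
    (hσ : ∀ v, rowHom a b c d (fun i => v (σ.symm i)) = fun i => rowHom a b c d v (σ.symm i))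
    {n : ℕ} (hn : n ≠ 0) :
    Nat.card (MulAction.fixedBy (OrbifoldGroup n) σ) = tetraFixed σ n := by
  obtain ⟨f, hf, hfker, hfφ⟩ := exists_surjection (rowHom a b c d) ψ hφ hψ hker
  refine card_fixedBy_orbifoldGroup f hf hfker (fun v => Subtype.ext ?_) hn
  rw [hfφ, hσ, ← hfφ]
  rfl

/-- The surjection `v ↦ (v₀ - v₃, v₁ - v₃, v₂ - v₃, 3 v₃ - v₀ - v₁ - v₂)`. -/
lemma exists_surjection_sub_last : ∃ f : (Fin 4 → ℤ) →+ tetraLattice, Function.Surjective f ∧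
    f.ker = AddSubgroup.zmultiples 1 ∧
    ∀ v, (f v).1 = rowHom ![1, 0, 0, -1] ![0, 1, 0, -1] ![0, 0, 1, -1] ![-1, -1, -1, 3] v := by
  refine exists_surjection _ (fun w => ![w 0, w 1, w 2, 0]) ?_ ?_ ?_
  · intro v
    simp [rowHom_apply, Fin.sum_univ_four]
    ring
  · intro w hw
    rw [Fin.sum_univ_four] at hw
    funext i
    fin_cases i <;> simp [rowHom_apply]
    omega
  · intro v
    simp [rowHom_apply, Fin.forall_fin_succ]
    omega

lemma card_fixedBy_orbifoldGroup_one {n : ℕ} (hn : n ≠ 0) :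
    Nat.card (MulAction.fixedBy (OrbifoldGroup n) (1 : Equiv.Perm (Fin 4))) = tetraFixed 1 n := by
  obtain ⟨f, hf, hker, -⟩ := exists_surjection_sub_last
  exact card_fixedBy_orbifoldGroup f hf hker (fun _ => rfl) hn

lemma card_fixedBy_orbifoldGroup_permTwo {n : ℕ} (hn : n ≠ 0) :
    Nat.card (MulAction.fixedBy (OrbifoldGroup n) permTwo) = tetraFixed permTwo n := by
  refine card_fixedBy_orbifoldGroup_of_rows ![1, 0, 0, -1] ![0, 1, 0, -1] ![-1, -1, 1, 1]
    ![0, 0, -1, 1] (fun w => ![w 0, w 1, -w 3, 0]) ?_ ?_ ?_ ?_ hn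
  · intro v
    simp [rowHom_apply, Fin.sum_univ_four]
    ring
  · intro w hw
    rw [Fin.sum_univ_four] at hw
    funext i
    fin_cases i <;> simp [rowHom_apply]
    omega
  · intro v
    simp [rowHom_apply, Fin.forall_fin_succ]
    omega
  · intro v
    funext i
    fin_cases i <;> simp [rowHom_apply, permTwo_symm]
    omega

lemma card_fixedBy_orbifoldGroup_permTwoTwo {n : ℕ} (hn : n ≠ 0) :
    Nat.card (MulAction.fixedBy (OrbifoldGroup n) permTwoTwo) = tetraFixed permTwoTwo n := by
  refine card_fixedBy_orbifoldGroup_of_rows ![1, 0, 0, -1] ![0, 1, -1, 0] ![-1, 0, 1, 0]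
    ![0, -1, 0, 1] (fun w => ![w 0, -w 3, w 2 + w 0, 0]) ?_ ?_ ?_ ?_ hn
  · intro v
    simp [rowHom_apply, Fin.sum_univ_four]
    ring
  · intro w hw
    rw [Fin.sum_univ_four] at hw
    funext i
    fin_cases i <;> simp [rowHom_apply]
    omega
  · intro v
    simp [rowHom_apply, Fin.forall_fin_succ]
    omega
  · intro v
    funext i
    fin_cases i <;> simp [rowHom_apply, permTwoTwo_symm]

lemma card_fixedBy_orbifoldGroup_permThree {n : ℕ} (hn : n ≠ 0) :
    Nat.card (MulAction.fixedBy (OrbifoldGroup n) permThree) = tetraFixed permThree n := by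
  obtain ⟨f, hf, hker, hfv⟩ := exists_surjection_sub_last
  refine card_fixedBy_orbifoldGroup f hf hker (fun v => Subtype.ext ?_) hn
  change _ = fun i => (f v).1 (permThree.symm i)
  rw [hfv, hfv]
  funext i
  fin_cases i <;> simp [rowHom_apply, permThree_symm]
  omega

/-- The surjection is `v ↦ v - σ v`. -/
lemma card_fixedBy_orbifoldGroup_permFour {n : ℕ} (hn : n ≠ 0) :
    Nat.card (MulAction.fixedBy (OrbifoldGroup n) permFour) = tetraFixed permFour n := by
  refine card_fixedBy_orbifoldGroup_of_rows ![1, 0, 0, -1] ![-1, 1, 0, 0] ![0, -1, 1, 0]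
    ![0, 0, -1, 1] (fun w => ![w 0, w 0 + w 1, w 0 + w 1 + w 2, 0]) ?_ ?_ ?_ ?_ hn
  · intro v
    simp [rowHom_apply, Fin.sum_univ_four]
    ring
  · intro w hw
    rw [Fin.sum_univ_four] at hw
    funext i
    fin_cases i <;> simp [rowHom_apply]
    all_goals omega
  · intro v
    simp [rowHom_apply, Fin.forall_fin_succ]
    omega
  · intro v
    funext i
    fin_cases i <;> simp [rowHom_apply, permFour_symm]
    all_goals omega

lemma cycleType_perm_four (σ : Equiv.Perm (Fin 4)) :
    σ.cycleType = 0 ∨ σ.cycleType = {2} ∨ σ.cycleType = {2, 2} ∨ σ.cycleType = {3} ∨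
      σ.cycleType = {4} := by
  revert σ
  decide

/-- Every permutation fixes as many orbifold groups as sublattices. -/
lemma card_fixedBy_orbifoldGroup_eq (σ : Equiv.Perm (Fin 4)) {n : ℕ} (hn : n ≠ 0) :
    Nat.card (MulAction.fixedBy (OrbifoldGroup n) σ) = tetraFixed σ n := by
  have key : ∀ τ : Equiv.Perm (Fin 4), σ.cycleType = τ.cycleType →
      Nat.card (MulAction.fixedBy (OrbifoldGroup n) τ) = tetraFixed τ n →
      Nat.card (MulAction.fixedBy (OrbifoldGroup n) σ) = tetraFixed σ n := fun τ h hτ => by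
    rw [card_fixedBy_eq_of_isConj (Equiv.Perm.isConj_iff_cycleType_eq.2 h), hτ, tetraFixed_congr h]
  rcases cycleType_perm_four σ with h | h | h | h | h
  · exact key 1 (h.trans Equiv.Perm.cycleType_one.symm) (card_fixedBy_orbifoldGroup_one hn)
  · exact key permTwo (h.trans cycleType_permTwo.symm) (card_fixedBy_orbifoldGroup_permTwo hn)
  · exact key permTwoTwo (h.trans cycleType_permTwoTwo.symm)
      (card_fixedBy_orbifoldGroup_permTwoTwo hn)
  · exact key permThree (h.trans cycleType_permThree.symm) (card_fixedBy_orbifoldGroup_permThree hn)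
  · exact key permFour (h.trans cycleType_permFour.symm) (card_fixedBy_orbifoldGroup_permFour hn)

lemma finite_orbifoldGroup {n : ℕ} (hn : n ≠ 0) : Finite (OrbifoldGroup n) := by
  obtain ⟨f, hf, hker, -⟩ := exists_surjection_sub_last
  have := finite_tetraSublattice hn
  exact Finite.of_equiv _ ((orbifoldEquiv hn).trans (sublatticeEquiv f hf hker n)).symm

/-! ### Counting orbits -/

/-- Burnside's lemma for a finite set. -/
lemma card_orbits_mul_card (G X : Type*) [Group G] [Fintype G] [MulAction G X] [Finite X] :
    Nat.card (MulAction.orbitRel.Quotient G X) * Fintype.card G =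
      ∑ g : G, Nat.card (MulAction.fixedBy X g) := by
  classical
  have := fun g : G => Fintype.ofFinite (MulAction.fixedBy X g)
  have := Fintype.ofFinite (MulAction.orbitRel.Quotient G X)
  rw [Nat.card_eq_fintype_card, ← MulAction.sum_card_fixedBy_eq_card_orbits_mul_card_group]
  exact Finset.sum_congr rfl fun g _ => (Nat.card_eq_fintype_card).symm

lemma tetraCount_mul {n : ℕ} (hn : n ≠ 0) :
    tetraCount n * 24 = ∑ σ : Equiv.Perm (Fin 4), tetraFixed σ n := by
  have := finite_tetraSublattice hn
  exact card_orbits_mul_card (Equiv.Perm (Fin 4)) (TetraSublattice n)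

lemma orbifoldCount_eq_tetraCount {n : ℕ} (hn : n ≠ 0) : orbifoldCount n = tetraCount n := by
  have := finite_orbifoldGroup hn
  have h := card_orbits_mul_card (Equiv.Perm (Fin 4)) (OrbifoldGroup n)
  rw [Finset.sum_congr rfl fun σ _ => card_fixedBy_orbifoldGroup_eq σ hn] at h
  exact Nat.eq_of_mul_eq_mul_right (by norm_num : 0 < 24) (h.trans (tetraCount_mul hn).symm)

/-- The cycle index of `S₄`. -/
lemma tetraCount_mul_eq {n : ℕ} (hn : n ≠ 0) :
    tetraCount n * 24 = tetraFixed 1 n + 6 * tetraFixed permTwo n + 3 * tetraFixed permTwoTwo n +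
      8 * tetraFixed permThree n + 6 * tetraFixed permFour n := by
  have hfib : ∀ τ : Equiv.Perm (Fin 4),
      ∑ σ with σ.cycleType = τ.cycleType, tetraFixed σ n =
        (Finset.univ.filter fun σ : Equiv.Perm (Fin 4) => σ.cycleType = τ.cycleType).card *
          tetraFixed τ n := fun τ => by
    rw [Finset.sum_congr rfl fun σ hσ => tetraFixed_congr (Finset.mem_filter.1 hσ).2 n,
      Finset.sum_const, smul_eq_mul]
  have h0 := hfib 1
  have h2 := hfib permTwo
  have h22 := hfib permTwoTwo
  have h3 := hfib permThree
  have h4 := hfib permFour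
  rw [cycleType_permTwo] at h2
  rw [cycleType_permTwoTwo] at h22
  rw [cycleType_permThree] at h3
  rw [cycleType_permFour] at h4
  rw [Equiv.Perm.cycleType_one] at h0
  have c0 : (Finset.univ.filter fun σ : Equiv.Perm (Fin 4) => σ.cycleType = 0).card = 1 := by decide
  have c2 : (Finset.univ.filter fun σ : Equiv.Perm (Fin 4) => σ.cycleType = {2}).card = 6 := by
    decide
  have c22 : (Finset.univ.filter fun σ : Equiv.Perm (Fin 4) => σ.cycleType = {2, 2}).card = 3 := by
    decide
  have c3 : (Finset.univ.filter fun σ : Equiv.Perm (Fin 4) => σ.cycleType = {3}).card = 8 := by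
    decide
  have c4 : (Finset.univ.filter fun σ : Equiv.Perm (Fin 4) => σ.cycleType = {4}).card = 6 := by
    decide
  rw [c0, one_mul] at h0
  rw [c2] at h2
  rw [c22] at h22
  rw [c3] at h3
  rw [c4] at h4
  rw [tetraCount_mul hn, ← h0, ← h2, ← h22, ← h3, ← h4,
    ← Finset.sum_fiberwise_of_maps_to (t := {0, {2}, {2, 2}, {3}, {4}}) (g := Equiv.Perm.cycleType)
      (fun σ _ => by simpa using cycleType_perm_four σ),
    Finset.sum_insert (by decide), Finset.sum_insert (by decide), Finset.sum_insert (by decide),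
    Finset.sum_insert (by decide), Finset.sum_singleton]
  ring

/-! ### Dirichlet series -/

section DirichletSeries

variable {s a b : ℂ} {f g : ArithmeticFunction ℤ}

/-- The Dirichlet series of a convolution is the product of the Dirichlet series. -/
lemma LSeriesHasSum.intMul (hf : LSeriesHasSum (fun n => (f n : ℂ)) s a)
    (hg : LSeriesHasSum (fun n => (g n : ℂ)) s b) :
    LSeriesHasSum (fun n => ((f * g) n : ℂ)) s (a * b) := by
  have h := ArithmeticFunction.LSeriesHasSum_mul
    (f := (f : ArithmeticFunction ℂ)) (g := (g : ArithmeticFunction ℂ)) hf hg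
  rwa [← ArithmeticFunction.intCoe_mul] at h

lemma LSeriesHasSum_oneSeq (hs : 1 < s.re) :
    LSeriesHasSum (fun n => (oneSeq n : ℂ)) s (riemannZeta s) := by
  refine (LSeriesHasSum_congr s _ fun {n} hn => ?_).1 (LSeriesHasSum_one hs)
  simp [oneSeq_apply hn]

lemma LSeriesHasSum_natCast_pow (k : ℕ) (hs : k + 1 < s.re) :
    LSeriesHasSum (fun n => (n : ℂ) ^ k) s (riemannZeta (s - k)) := by
  have h := LSeriesHasSum_one (s := s - k) (by simp; linarith)
  have heq : LSeries.term (fun n => (n : ℂ) ^ k) s = LSeries.term 1 (s - k) := by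
    funext n
    rcases eq_or_ne n 0 with rfl | hn
    · simp
    · have hn' : (n : ℂ) ≠ 0 := Nat.cast_ne_zero.2 hn
      rw [LSeries.term_of_ne_zero hn, LSeries.term_of_ne_zero hn, Complex.cpow_sub _ _ hn',
        Complex.cpow_natCast, Pi.one_apply, one_div_div]
  rw [LSeriesHasSum, heq]
  exact h

lemma LSeriesHasSum_natSeq (hs : 2 < s.re) :
    LSeriesHasSum (fun n => (natSeq n : ℂ)) s (riemannZeta (s - 1)) := by
  simpa [natSeq_apply] using LSeriesHasSum_natCast_pow (s := s) 1 (by norm_num; linarith)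

lemma LSeriesHasSum_sqSeq (hs : 3 < s.re) :
    LSeriesHasSum (fun n => (sqSeq n : ℂ)) s (riemannZeta (s - 2)) := by
  simpa [sqSeq_apply] using LSeriesHasSum_natCast_pow (s := s) 2 (by norm_num; linarith)

lemma LSeriesHasSum_deltaSeq {p : ℕ} (hp : p ≠ 0) :
    LSeriesHasSum (fun n => (deltaSeq p n : ℂ)) s ((p : ℂ) ^ (-s)) := by
  have h := hasSum_single (f := LSeries.term (fun n => (deltaSeq p n : ℂ)) s) p fun n hn => by
    rcases eq_or_ne n 0 with rfl | h0
    · simp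
    · simp [LSeries.term_of_ne_zero h0, deltaSeq_apply h0, hn]
  rw [LSeries.term_of_ne_zero hp, deltaSeq_apply hp, if_pos rfl, Int.cast_one, one_div,
    ← Complex.cpow_neg] at h
  exact h

/-- The Dirichlet polynomial with coefficient `-1` at `p` and `c` at `p ^ 2`. -/
lemma LSeriesHasSum_one_sub_deltaSeq_add {p : ℕ} (hp : p ≠ 0) (c : ℕ) :
    LSeriesHasSum
      (fun n => ((1 - deltaSeq p + (c : ArithmeticFunction ℤ) * (deltaSeq p * deltaSeq p)) n : ℂ)) s
      (1 - (p : ℂ) ^ (-s) + c * ((p : ℂ) ^ (-s) * (p : ℂ) ^ (-s))) := by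
  have h1 : LSeriesHasSum (fun n => (deltaSeq 1 n : ℂ)) s 1 := by
    simpa using LSeriesHasSum_deltaSeq (s := s) one_ne_zero
  have hd := LSeriesHasSum_deltaSeq (s := s) hp
  refine (LSeriesHasSum_congr s _ fun {n} hn => ?_).1
    ((h1.sub hd).add ((hd.intMul hd).smul (c : ℂ)))
  simp only [Pi.add_apply, Pi.sub_apply, Pi.smul_apply, smul_eq_mul, ArithmeticFunction.add_apply,
    ArithmeticFunction.sub_apply', natCast_mul_apply, deltaSeq_apply hn,
    ArithmeticFunction.one_apply]
  push_cast
  ring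

lemma LSeriesHasSum_finiteSeq_four :
    LSeriesHasSum (fun n => (finiteSeq [1, -1, 0, 4] n : ℂ)) s
      (1 - 2 ^ (-s) + 2 ^ (2 - 2 * s)) := by
  have h := LSeriesHasSum_one_sub_deltaSeq_add (s := s) two_ne_zero 4
  have hf := finiteSeq_two_eq 4
  rw [Nat.cast_ofNat] at hf
  rw [← hf] at h
  convert h using 1
  rw [show 2 - 2 * s = 2 + (-s + -s) by ring, Complex.cpow_add _ _ two_ne_zero,
    Complex.cpow_add _ _ two_ne_zero, show (2 : ℂ) ^ (2 : ℂ) = 4 by norm_num]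
  simp

lemma LSeriesHasSum_finiteSeq_two :
    LSeriesHasSum (fun n => (finiteSeq [1, -1, 0, 2] n : ℂ)) s
      (1 - 2 ^ (-s) + 2 ^ (1 - 2 * s)) := by
  have h := LSeriesHasSum_one_sub_deltaSeq_add (s := s) two_ne_zero 2
  have hf := finiteSeq_two_eq 2
  rw [Nat.cast_ofNat] at hf
  rw [← hf] at h
  convert h using 1
  rw [show 1 - 2 * s = 1 + (-s + -s) by ring, Complex.cpow_add _ _ two_ne_zero,
    Complex.cpow_add _ _ two_ne_zero, Complex.cpow_one]
  simp

lemma LSeriesHasSum_finiteSeq_three :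
    LSeriesHasSum (fun n => (finiteSeq [1, 0, -1, 0, 0, 0, 0, 0, 3] n : ℂ)) s
      (1 - 3 ^ (-s) + 3 ^ (1 - 2 * s)) := by
  have h := LSeriesHasSum_one_sub_deltaSeq_add (s := s) three_ne_zero 3
  rw [← finiteSeq_three_eq] at h
  convert h using 1
  rw [show 1 - 2 * s = 1 + (-s + -s) by ring, Complex.cpow_add _ _ three_ne_zero,
    Complex.cpow_add _ _ three_ne_zero, Complex.cpow_one]
  simp

lemma LSeriesHasSum_dirichletCharacter {N : ℕ} [NeZero N] (χ : DirichletCharacter ℂ N)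
    (hs : 1 < s.re) : LSeriesHasSum (fun n => χ n) s (χ.LFunction s) := by
  rw [χ.LFunction_eq_LSeries hs]
  exact (χ.LSeriesSummable_of_one_lt_re hs).LSeriesHasSum

lemma LSeriesHasSum_chiThreeSeq (hs : 1 < s.re) :
    LSeriesHasSum (fun n => (chiThreeSeq n : ℂ)) s (LChiThree s) :=
  LSeriesHasSum_dirichletCharacter (chiThree.ringHomComp (Int.castRingHom ℂ)) hs

lemma LSeriesHasSum_chiFourSeq (hs : 1 < s.re) :
    LSeriesHasSum (fun n => (chiFourSeq n : ℂ)) s (LChiFour s) :=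
  LSeriesHasSum_dirichletCharacter (chiFour.ringHomComp (Int.castRingHom ℂ)) hs

/-- A sequence of natural numbers that agrees with an arithmetic function away from `0` has the
same Dirichlet series. -/
lemma LSeriesHasSum.of_intCast_eq {u : ℕ → ℕ} (hf : LSeriesHasSum (fun n => (f n : ℂ)) s a)
    (h : ∀ n, n ≠ 0 → (u n : ℤ) = f n) : LSeriesHasSum (fun n => (u n : ℂ)) s a := by
  refine (LSeriesHasSum_congr s _ fun {n} hn => ?_).1 hf
  rw [← h n hn, Int.cast_natCast]

lemma LSeriesHasSum_tetraFixed_one (hs : 3 < s.re) :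
    LSeriesHasSum (fun n => (tetraFixed 1 n : ℂ)) s
      (riemannZeta s * riemannZeta (s - 1) * riemannZeta (s - 2)) :=
  (((LSeriesHasSum_oneSeq (by linarith)).intMul (LSeriesHasSum_natSeq (by linarith))).intMul
    (LSeriesHasSum_sqSeq hs)).of_intCast_eq fun _ hn => tetraFixed_one hn

lemma LSeriesHasSum_finiteSeq_four_mul (hs : 2 < s.re) :
    LSeriesHasSum (fun n => ((finiteSeq [1, -1, 0, 4] * oneSeq * oneSeq * natSeq) n : ℂ)) s
      ((1 - 2 ^ (-s) + 2 ^ (2 - 2 * s)) * riemannZeta s ^ 2 * riemannZeta (s - 1)) := by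
  have h1 := LSeriesHasSum_oneSeq (s := s) (by linarith)
  rw [sq, ← mul_assoc]
  exact ((LSeriesHasSum_finiteSeq_four.intMul h1).intMul h1).intMul (LSeriesHasSum_natSeq hs)

lemma LSeriesHasSum_tetraFixed_permTwo (hs : 2 < s.re) :
    LSeriesHasSum (fun n => (tetraFixed permTwo n : ℂ)) s
      ((1 - 2 ^ (-s) + 2 ^ (2 - 2 * s)) * riemannZeta s ^ 2 * riemannZeta (s - 1)) :=
  (LSeriesHasSum_finiteSeq_four_mul hs).of_intCast_eq fun _ hn => tetraFixed_permTwo hn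

lemma LSeriesHasSum_tetraFixed_permTwoTwo (hs : 2 < s.re) :
    LSeriesHasSum (fun n => (tetraFixed permTwoTwo n : ℂ)) s
      ((1 - 2 ^ (-s) + 2 ^ (2 - 2 * s)) * riemannZeta s ^ 2 * riemannZeta (s - 1)) :=
  (LSeriesHasSum_finiteSeq_four_mul hs).of_intCast_eq fun _ hn => tetraFixed_permTwoTwo hn

lemma LSeriesHasSum_tetraFixed_permThree (hs : 1 < s.re) :
    LSeriesHasSum (fun n => (tetraFixed permThree n : ℂ)) s
      ((1 - 3 ^ (-s) + 3 ^ (1 - 2 * s)) * riemannZeta s ^ 2 * LChiThree s) := by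
  have h1 := LSeriesHasSum_oneSeq hs
  rw [sq, ← mul_assoc]
  exact (((LSeriesHasSum_finiteSeq_three.intMul h1).intMul h1).intMul
    (LSeriesHasSum_chiThreeSeq hs)).of_intCast_eq fun _ hn => tetraFixed_permThree hn

lemma LSeriesHasSum_tetraFixed_permFour (hs : 1 < s.re) :
    LSeriesHasSum (fun n => (tetraFixed permFour n : ℂ)) s
      ((1 - 2 ^ (-s) + 2 ^ (1 - 2 * s)) * riemannZeta s ^ 2 * LChiFour s) := by
  have h1 := LSeriesHasSum_oneSeq hs
  rw [sq, ← mul_assoc]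
  exact (((LSeriesHasSum_finiteSeq_two.intMul h1).intMul h1).intMul
    (LSeriesHasSum_chiFourSeq hs)).of_intCast_eq fun _ hn => tetraFixed_permFour hn

lemma LSeriesHasSum_tetraCount (hs : 3 < s.re) :
    LSeriesHasSum (fun n => (tetraCount n : ℂ)) s (tetraDirichlet s) := by
  have hs1 : 1 < s.re := by linarith
  have hs2 : 2 < s.re := by linarith
  have h := (((((LSeriesHasSum_tetraFixed_one hs).add
    ((LSeriesHasSum_tetraFixed_permTwo hs2).smul 6)).add
    ((LSeriesHasSum_tetraFixed_permTwoTwo hs2).smul 3)).add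
    ((LSeriesHasSum_tetraFixed_permThree hs1).smul 8)).add
    ((LSeriesHasSum_tetraFixed_permFour hs1).smul 6)).smul (1 / 24 : ℂ)
  convert (LSeriesHasSum_congr (g := fun n => (tetraCount n : ℂ)) s _ fun {n} hn => ?_).1 h using 1
  · rw [tetraDirichlet]
    ring
  · have hc := congrArg (Nat.cast : ℕ → ℂ) (tetraCount_mul_eq hn)
    push_cast at hc
    simp only [Pi.add_apply, Pi.smul_apply, smul_eq_mul]
    linear_combination -(1 / 24 : ℂ) * hc

end DirichletSeries

/-! ### Meromorphic continuation -/

section Meromorphic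

open Filter Topology

lemma analyticAt_riemannZeta {s : ℂ} (hs : s ≠ 1) : AnalyticAt ℂ riemannZeta s := by
  refine DifferentiableOn.analyticAt (s := {1}ᶜ) (fun z hz => ?_)
    (isOpen_compl_singleton.mem_nhds hs)
  exact (differentiableAt_riemannZeta hz).differentiableWithinAt

lemma analyticAt_riemannZeta_sub {s c : ℂ} (hs : s - c ≠ 1) :
    AnalyticAt ℂ (fun s => riemannZeta (s - c)) s :=
  AnalyticAt.fun_comp (f := fun s => s - c) (analyticAt_riemannZeta hs) (by fun_prop)

/-- The Riemann zeta function has a simple pole at `1`. -/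
lemma exists_analyticAt_riemannZeta_eq_inv_mul :
    ∃ g : ℂ → ℂ, AnalyticAt ℂ g 1 ∧ g 1 = 1 ∧
      ∀ᶠ z in 𝓝[≠] (1 : ℂ), riemannZeta z = (z - 1)⁻¹ * g z := by
  refine ⟨Function.update (fun z => (z - 1) * riemannZeta z) 1 1, ?_, by simp, ?_⟩
  · refine Complex.analyticAt_of_differentiable_on_punctured_nhds_of_continuousAt ?_
      (continuousAt_update_same.2 riemannZeta_residue_one)
    filter_upwards [self_mem_nhdsWithin] with z hz
    have hd : DifferentiableAt ℂ (fun z => (z - 1) * riemannZeta z) z :=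
      (by fun_prop : DifferentiableAt ℂ (fun z : ℂ => z - 1) z).mul
        (differentiableAt_riemannZeta hz)
    refine hd.congr_of_eventuallyEq ?_
    filter_upwards [isOpen_compl_singleton.mem_nhds hz] with w hw
    exact Function.update_of_ne hw _ _
  · filter_upwards [self_mem_nhdsWithin] with z hz
    rw [Function.update_of_ne hz, inv_mul_cancel_left₀ (sub_ne_zero.2 hz)]

lemma meromorphic_riemannZeta : Meromorphic riemannZeta := by
  intro s
  rcases eq_or_ne s 1 with rfl | hs
  · obtain ⟨g, hg, -, h⟩ := exists_analyticAt_riemannZeta_eq_inv_mul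
    refine MeromorphicAt.congr (f := fun z => (z - 1)⁻¹ * g z) ?_ (h.mono fun z hz => hz.symm)
    exact (by fun_prop : MeromorphicAt (fun z : ℂ => z - 1) 1).inv.mul hg.meromorphicAt
  · exact (analyticAt_riemannZeta hs).meromorphicAt

lemma Meromorphic.comp_sub_const {f : ℂ → ℂ} (hf : Meromorphic f) (c : ℂ) :
    Meromorphic fun s => f (s - c) := by
  intro s
  exact MeromorphicAt.comp_analyticAt (g := fun s => s - c) (hf (s - c)) (by fun_prop)

lemma chiThree_ringHomComp_ne_one : chiThree.ringHomComp (Int.castRingHom ℂ) ≠ 1 := by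
  intro h
  have h2 := congrArg (fun χ : MulChar (ZMod 3) ℂ => χ 2) h
  have h3 : chiThree 2 = -1 := by decide
  have h4 : (1 : MulChar (ZMod 3) ℂ) 2 = 1 := MulChar.one_apply (by decide)
  simp only [MulChar.ringHomComp_apply, h3, h4] at h2
  norm_num at h2

lemma chiFour_ringHomComp_ne_one : chiFour.ringHomComp (Int.castRingHom ℂ) ≠ 1 := by
  intro h
  have h2 := congrArg (fun χ : MulChar (ZMod 4) ℂ => χ 3) h
  have h3 : chiFour 3 = -1 := by decide
  have h4 : (1 : MulChar (ZMod 4) ℂ) 3 = 1 := MulChar.one_apply (by decide)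
  simp only [MulChar.ringHomComp_apply, h3, h4] at h2
  norm_num at h2

lemma differentiable_LChiThree : Differentiable ℂ LChiThree :=
  DirichletCharacter.differentiable_LFunction chiThree_ringHomComp_ne_one

lemma differentiable_LChiFour : Differentiable ℂ LChiFour :=
  DirichletCharacter.differentiable_LFunction chiFour_ringHomComp_ne_one

/-- The part of `tetraDirichlet` that has no pole on `2 < re s`: the sum of all terms without the
factor `ζ(s - 2)`. -/
noncomputable def tetraDirichletRest (s : ℂ) : ℂ :=
  riemannZeta s * riemannZeta (s - 1) / 24 *
      (9 * (1 - 2 ^ (-s) + 2 ^ (2 - 2 * s)) * riemannZeta s) +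
    riemannZeta s ^ 2 / 24 *
      (8 * (1 - 3 ^ (-s) + 3 ^ (1 - 2 * s)) * LChiThree s +
        6 * (1 - 2 ^ (-s) + 2 ^ (1 - 2 * s)) * LChiFour s)

lemma tetraDirichlet_eq (s : ℂ) :
    tetraDirichlet s =
      riemannZeta (s - 2) * (riemannZeta s * riemannZeta (s - 1) / 24) + tetraDirichletRest s := by
  rw [tetraDirichlet, tetraDirichletRest]
  ring

lemma differentiable_one_sub_cpow_add_cpow {p : ℂ} (hp : p ≠ 0) (c : ℂ) :
    Differentiable ℂ fun s : ℂ => 1 - p ^ (-s) + p ^ (c - 2 * s) := by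
  fun_prop (disch := exact Or.inl hp)

lemma meromorphic_tetraDirichletRest : Meromorphic tetraDirichletRest := by
  intro s
  have hz := meromorphic_riemannZeta s
  have hz1 := meromorphic_riemannZeta.comp_sub_const 1 s
  have h3 := (differentiable_LChiThree.analyticAt s).meromorphicAt
  have h4 := (differentiable_LChiFour.analyticAt s).meromorphicAt
  have e1 := ((differentiable_one_sub_cpow_add_cpow two_ne_zero 2).analyticAt s).meromorphicAt
  have e2 := ((differentiable_one_sub_cpow_add_cpow three_ne_zero 1).analyticAt s).meromorphicAt
  have e3 := ((differentiable_one_sub_cpow_add_cpow two_ne_zero 1).analyticAt s).meromorphicAt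
  have c (w : ℂ) : MeromorphicAt (fun _ : ℂ => w) s := MeromorphicAt.const w s
  exact (((hz.mul hz1).div (c 24)).mul (((c 9).mul e1).mul hz)).add
    (((hz.pow 2).div (c 24)).mul ((((c 8).mul e2).mul h3).add (((c 6).mul e3).mul h4)))

lemma analyticAt_zeta_mul_zeta {s : ℂ} (hs : s ≠ 1) (hs' : s ≠ 2) :
    AnalyticAt ℂ (fun s => riemannZeta s * riemannZeta (s - 1) / 24) s := by
  have hz1 : AnalyticAt ℂ (fun s => riemannZeta (s - 1)) s :=
    analyticAt_riemannZeta_sub fun h => hs' (by linear_combination h)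
  exact ((analyticAt_riemannZeta hs).mul hz1).div analyticAt_const (by norm_num)

lemma analyticAt_tetraDirichletRest {s : ℂ} (hs : s ≠ 1) (hs' : s ≠ 2) :
    AnalyticAt ℂ tetraDirichletRest s := by
  have hz := analyticAt_riemannZeta hs
  have h3 := differentiable_LChiThree.analyticAt s
  have h4 := differentiable_LChiFour.analyticAt s
  have e1 := (differentiable_one_sub_cpow_add_cpow two_ne_zero 2).analyticAt s
  have e2 := (differentiable_one_sub_cpow_add_cpow three_ne_zero 1).analyticAt s
  have e3 := (differentiable_one_sub_cpow_add_cpow two_ne_zero 1).analyticAt s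
  have c (w : ℂ) : AnalyticAt ℂ (fun _ : ℂ => w) s := analyticAt_const
  exact ((analyticAt_zeta_mul_zeta hs hs').mul (((c 9).mul e1).mul hz)).add
    (((hz.pow 2).div (c 24) (by norm_num)).mul
      ((((c 8).mul e2).mul h3).add (((c 6).mul e3).mul h4)))

lemma meromorphic_tetraDirichlet : Meromorphic tetraDirichlet := by
  intro s
  rw [funext tetraDirichlet_eq]
  exact ((meromorphic_riemannZeta.comp_sub_const 2 s).mul
    (((meromorphic_riemannZeta s).mul (meromorphic_riemannZeta.comp_sub_const 1 s)).div
      (MeromorphicAt.const 24 s))).add (meromorphic_tetraDirichletRest s)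

lemma analyticAt_tetraDirichlet {s : ℂ} (hs : 3 ≤ s.re) (hs3 : s ≠ 3) :
    AnalyticAt ℂ tetraDirichlet s := by
  have h1 : s ≠ 1 := by rintro rfl; norm_num at hs
  have h2 : s ≠ 2 := by rintro rfl; norm_num at hs
  rw [funext tetraDirichlet_eq]
  have hz2 : AnalyticAt ℂ (fun s => riemannZeta (s - 2)) s :=
    analyticAt_riemannZeta_sub fun h => hs3 (by linear_combination h)
  exact (hz2.mul (analyticAt_zeta_mul_zeta h1 h2)).add (analyticAt_tetraDirichletRest h1 h2)

/-- The pole comes from `ζ(s - 2)`; its coefficient `ζ(3) ζ(2) / 24` does not vanish. -/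
lemma meromorphicOrderAt_tetraDirichlet_three : meromorphicOrderAt tetraDirichlet 3 = -1 := by
  obtain ⟨g, hg, hg1, h⟩ := exists_analyticAt_riemannZeta_eq_inv_mul
  have h1 : (3 : ℂ) ≠ 1 := by norm_num
  have h2 : (3 : ℂ) ≠ 2 := by norm_num
  have h32 : (3 : ℂ) - 2 = 1 := by norm_num
  refine (meromorphicOrderAt_eq_int_iff (n := -1) (meromorphic_tetraDirichlet 3)).2
    ⟨fun s => g (s - 2) * (riemannZeta s * riemannZeta (s - 1) / 24) +
      (s - 3) * tetraDirichletRest s, ?_, ?_, ?_⟩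
  · have hg' : AnalyticAt ℂ (fun s => g (s - 2)) 3 :=
      AnalyticAt.fun_comp (g := g) (f := fun s => s - 2) (by rwa [h32]) (by fun_prop)
    exact (hg'.mul (analyticAt_zeta_mul_zeta h1 h2)).add
      ((by fun_prop : AnalyticAt ℂ (fun s : ℂ => s - 3) 3).mul
        (analyticAt_tetraDirichletRest h1 h2))
  · have hz3 : riemannZeta 3 ≠ 0 := riemannZeta_ne_zero_of_one_le_re (by norm_num)
    have hz2 : riemannZeta (3 - 1) ≠ 0 := riemannZeta_ne_zero_of_one_le_re (by norm_num)
    simp only [h32, hg1, sub_self, zero_mul, add_zero, one_mul]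
    exact div_ne_zero (mul_ne_zero hz3 hz2) (by norm_num)
  · have ht : Tendsto (fun s : ℂ => s - 2) (𝓝[≠] 3) (𝓝[≠] 1) := by
      refine tendsto_nhdsWithin_iff.2 ⟨?_, ?_⟩
      · have hc : ContinuousAt (fun s : ℂ => s - 2) 3 := by fun_prop
        rw [ContinuousAt, h32] at hc
        exact hc.mono_left nhdsWithin_le_nhds
      · filter_upwards [self_mem_nhdsWithin] with s hs h
        have h' : s - 2 = 1 := h
        exact hs (show s = 3 by linear_combination h')
    filter_upwards [ht.eventually h, self_mem_nhdsWithin] with s hs hs3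
    have hs3' : s - 3 ≠ 0 := sub_ne_zero.2 hs3
    rw [tetraDirichlet_eq, hs, zpow_neg_one, smul_eq_mul, show s - 2 - 1 = s - 3 by ring, mul_add,
      inv_mul_cancel_left₀ hs3', mul_assoc]

end Meromorphic

theorem mainTheorem4 :
    -- orbifolds of `ℂ⁴` are counted by the sublattices of the tetrahedral lattice up to `S₄`
    (∀ n : ℕ, n ≠ 0 → orbifoldCount n = tetraCount n) ∧
    -- the numbers of invariant sublattices, by cycle type: `x₁⁴`, `x₁² x₂`, `x₂²`, `x₁ x₃`, `x₄`
    (∀ σ : Equiv.Perm (Fin 4), σ.cycleType = 0 → ∀ n : ℕ, n ≠ 0 →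
      (tetraFixed σ n : ℤ) = (oneSeq * natSeq * sqSeq) n) ∧
    (∀ σ : Equiv.Perm (Fin 4), σ.cycleType = {2} → ∀ n : ℕ, n ≠ 0 →
      (tetraFixed σ n : ℤ) = (finiteSeq [1, -1, 0, 4] * oneSeq * oneSeq * natSeq) n) ∧
    (∀ σ : Equiv.Perm (Fin 4), σ.cycleType = {2, 2} → ∀ n : ℕ, n ≠ 0 →
      (tetraFixed σ n : ℤ) = (finiteSeq [1, -1, 0, 4] * oneSeq * oneSeq * natSeq) n) ∧
    (∀ σ : Equiv.Perm (Fin 4), σ.cycleType = {3} → ∀ n : ℕ, n ≠ 0 →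
      (tetraFixed σ n : ℤ) =
        (finiteSeq [1, 0, -1, 0, 0, 0, 0, 0, 3] * oneSeq * oneSeq * chiThreeSeq) n) ∧
    (∀ σ : Equiv.Perm (Fin 4), σ.cycleType = {4} → ∀ n : ℕ, n ≠ 0 →
      (tetraFixed σ n : ℤ) = (finiteSeq [1, -1, 0, 2] * oneSeq * oneSeq * chiFourSeq) n) ∧
    -- the decomposition according to the cycle index of `S₄`
    (∀ σ₂ σ₂₂ σ₃ σ₄ : Equiv.Perm (Fin 4), σ₂.cycleType = {2} → σ₂₂.cycleType = {2, 2} →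
      σ₃.cycleType = {3} → σ₄.cycleType = {4} → ∀ n : ℕ, n ≠ 0 →
      (tetraCount n : ℚ) = 1 / 24 * (tetraFixed 1 n + 6 * tetraFixed σ₂ n + 3 * tetraFixed σ₂₂ n +
        8 * tetraFixed σ₃ n + 6 * tetraFixed σ₄ n)) ∧
    -- the Dirichlet series of the five terms
    (∀ σ : Equiv.Perm (Fin 4), σ.cycleType = 0 → ∀ s : ℂ, 3 < s.re →
      LSeriesHasSum (fun n => (tetraFixed σ n : ℂ)) s
        (riemannZeta s * riemannZeta (s - 1) * riemannZeta (s - 2))) ∧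
    (∀ σ : Equiv.Perm (Fin 4), σ.cycleType = {2} ∨ σ.cycleType = {2, 2} → ∀ s : ℂ, 2 < s.re →
      LSeriesHasSum (fun n => (tetraFixed σ n : ℂ)) s
        ((1 - 2 ^ (-s) + 2 ^ (2 - 2 * s)) * riemannZeta s ^ 2 * riemannZeta (s - 1))) ∧
    (∀ σ : Equiv.Perm (Fin 4), σ.cycleType = {3} → ∀ s : ℂ, 1 < s.re →
      LSeriesHasSum (fun n => (tetraFixed σ n : ℂ)) s
        ((1 - 3 ^ (-s) + 3 ^ (1 - 2 * s)) * riemannZeta s ^ 2 * LChiThree s)) ∧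
    (∀ σ : Equiv.Perm (Fin 4), σ.cycleType = {4} → ∀ s : ℂ, 1 < s.re →
      LSeriesHasSum (fun n => (tetraFixed σ n : ℂ)) s
        ((1 - 2 ^ (-s) + 2 ^ (1 - 2 * s)) * riemannZeta s ^ 2 * LChiFour s)) ∧
    -- the Dirichlet series of the sublattice count
    (∀ s : ℂ, 3 < s.re → LSeriesHasSum (fun n => (tetraCount n : ℂ)) s (tetraDirichlet s)) ∧
    -- its meromorphic continuation has its rightmost pole at `s = 3`, of order one
    Meromorphic tetraDirichlet ∧
    meromorphicOrderAt tetraDirichlet 3 = -1 ∧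
    (∀ s : ℂ, 3 ≤ s.re → s ≠ 3 → AnalyticAt ℂ tetraDirichlet s) := by
  refine ⟨fun n hn => orbifoldCount_eq_tetraCount hn, fun σ h n hn => ?_, fun σ h n hn => ?_,
    fun σ h n hn => ?_, fun σ h n hn => ?_, fun σ h n hn => ?_,
    fun σ₂ σ₂₂ σ₃ σ₄ h2 h22 h3 h4 n hn => ?_, fun σ h s hs => ?_, fun σ h s hs => ?_,
    fun σ h s hs => ?_, fun σ h s hs => ?_, fun s hs => LSeriesHasSum_tetraCount hs,
    meromorphic_tetraDirichlet, meromorphicOrderAt_tetraDirichlet_three,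
    fun s hs hs3 => analyticAt_tetraDirichlet hs hs3⟩
  · rw [tetraFixed_congr (h.trans Equiv.Perm.cycleType_one.symm), tetraFixed_one hn]
  · rw [tetraFixed_congr (h.trans cycleType_permTwo.symm), tetraFixed_permTwo hn]
  · rw [tetraFixed_congr (h.trans cycleType_permTwoTwo.symm), tetraFixed_permTwoTwo hn]
  · rw [tetraFixed_congr (h.trans cycleType_permThree.symm), tetraFixed_permThree hn]
  · rw [tetraFixed_congr (h.trans cycleType_permFour.symm), tetraFixed_permFour hn]
  · rw [tetraFixed_congr (h2.trans cycleType_permTwo.symm),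
      tetraFixed_congr (h22.trans cycleType_permTwoTwo.symm),
      tetraFixed_congr (h3.trans cycleType_permThree.symm),
      tetraFixed_congr (h4.trans cycleType_permFour.symm)]
    have hc := congrArg (Nat.cast : ℕ → ℚ) (tetraCount_mul_eq hn)
    push_cast at hc
    linarith
  · simp only [tetraFixed_congr (h.trans Equiv.Perm.cycleType_one.symm)]
    exact LSeriesHasSum_tetraFixed_one hs
  · rcases h with h | h
    · simp only [tetraFixed_congr (h.trans cycleType_permTwo.symm)]
      exact LSeriesHasSum_tetraFixed_permTwo hs
    · simp only [tetraFixed_congr (h.trans cycleType_permTwoTwo.symm)]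
      exact LSeriesHasSum_tetraFixed_permTwoTwo hs
  · simp only [tetraFixed_congr (h.trans cycleType_permThree.symm)]
    exact LSeriesHasSum_tetraFixed_permThree hs
  · simp only [tetraFixed_congr (h.trans cycleType_permFour.symm)]
    exact LSeriesHasSum_tetraFixed_permFour hs
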